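/- Let $M$ be an inverse monoid given by an inverse monoid presentation $\mathcal P=[X:\mathcal R]$: here $A=X\sqcup X^{-1}$, $\mathcal R\subseteq A^*\times A^*$, $\rho:A^*\to \mathrm{FIM}(X)$ is the canonical map to the free inverse monoid, and $\theta:\mathrm{FIM}(X)\to M$ is a surjective homomorphism whose induced congruence is generated by the pairs $(l\rho,r\rho)$ with $(l,r)\in\mathcal R$. *Lausch modules.* For an inverse monoid $S$ with idempotents $E(S)$ (ordered by $f\le e\iff f=ef$), an $S$-module is a presheaf of abelian groups $A_e$ $(e\in E(S))$ over the semilattice $E(S)$ with a map $(a,s)\mapsto a\lhd s$ from $A\times S$ to $A$, where $A=\bigsqcup_e A_e$ carries the operation $a\oplus b=a|_{ef}+b|_{ef}$ for $a\in A_e$, $b\in A_f$, such that $(a\oplus b)\lhd s=(a\lhd s)\oplus(b\lhd s)$, $a\lhd st=(a\lhd s)\lhd t$, $a\lhd e=a\oplus 0_e$ and $0_e\lhd s=0_{s^{-1}es}$ for all $a,b\in A$, $s,t\in S$, $e\in E(S)$. The free $S$-module on a family of sets $(B_f)_{f\in E(S)}$ has as $F_e$ the free abelian group on $\{(b,s):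 b\in B_f,\ s\in S,\ f\ge ss^{-1},\ s^{-1}s=e\}$, with $(b,s)\lhd t=(b,st)$ and $(b,s)|_{e'}=(b,se')$; a module is free if it is isomorphic to one of these. Exactness of a sequence of $S$-modules means exactness at every $e\in E(S)$. *The relation module.* For $a,b\in\mathrm{FIM}(X)$ let $a\,\theta_{\min}\,b$ if there is an idempotent $e$ with $ae=be$ and $(a^{-1}a)\theta=e\theta=(b^{-1}b)\theta$. This is a congruence. Put $\mathcal T=\mathrm{FIM}(X)/\theta_{\min}$, and factor $\theta$ as $\mathrm{FIM}(X)\xrightarrow{\tau}\mathcal T\xrightarrow{\psi}M$. Then $\psi$ restricts to a bijection $E(\mathcal T)\to E(M)$, by which these sets are identified. For each idempotent $e$, $K_e=\{k\in\mathcal T:k\psi=e\psi\}$ is a group with identity $e$, and the relation module is the $M$-module $\mathcal K=\bigsqcup_e K_e^{ab}$ with $\overline{k}\lhd m=\overline{t^{-1}kt}$ for any $t\in\mathcal T$ with $t\psi=m$. *The Squier complex.* $\mathrm{Sq}(\mathcal P)$ is the $2$-complex with vertex set $\mathcal T$, an edge $(p,l,r,q)$ from $p(l\rho\tau)q$ to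 $p(r\rho\tau)q$ for all $p,q\in\mathcal T$ and $(l,r)\in\mathcal R$, and, for all $p,q,p',q'\in\mathcal T$ and $(l,r),(l',r')\in\mathcal R$, a $2$-cell attached along the square formed by the two paths $$(p,l,r,qp'(l'\rho\tau)q')\circ(p(r\rho\tau)qp',l',r',q')\quad\text{and}\quad(p(l\rho\tau)qp',l',r',q')\circ(p,l,r,qp'(r'\rho\tau)q').$$ Its fundamental groupoid $\pi$ on the vertex set $\mathcal T$, with domain and range maps $\mathbf d,\mathbf r$, has left and right actions of $\mathcal T$ induced by $t\rhd(p,l,r,q)=(tp,l,r,q)$ and $(p,l,r,q)\lhd t=(p,l,r,qt)$. Put $\alpha*\beta=(\alpha\lhd\beta\mathbf d)\circ(\alpha\mathbf r\rhd\beta)$. For an idempotent $e$ of $\mathcal T$, the set $\mathrm{star}_e^{\bowtie}=\{e\rhd\alpha\lhd e:\alpha\in\pi,\ \alpha\mathbf d=e\}$ is a group under $*$, $\mathbf r$ restricts to a homomorphism $\mathrm{star}_e^{\bowtie}\to K_e$, and $\pi_e^{\bowtie}=\{\alpha\in\mathrm{star}_e^{\bowtie}:\alpha\mathbf r=e\}$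 is an abelian subgroup. The maps $\alpha\mapsto t^{-1}\rhd\alpha\lhd t$, for any $t\in\mathcal T$ with $t\psi=m$, define the action of $m\in M$ that makes the module of identities $\bigsqcup_e\pi_e^{\bowtie}$ and $(S^{\bowtie})^{ab}=\bigsqcup_e(\mathrm{star}_e^{\bowtie})^{ab}$ into $M$-modules. **Theorem.** For every inverse monoid presentation $\mathcal P$ of an inverse monoid $M$ there is a short exact sequence of $M$-modules $$0\longrightarrow\bigsqcup_{e\in E(M)}\pi_e^{\bowtie}\longrightarrow(S^{\bowtie})^{ab}\xrightarrow{\ \overline{\mathbf r}\ }\mathcal K\longrightarrow0,$$ in which the first map is induced by the inclusions $\pi_e^{\bowtie}\subseteq\mathrm{star}_e^{\bowtie}$, the map $\overline{\mathbf r}$ is induced by the range maps $\mathbf r:\mathrm{star}_e^{\bowtie}\to K_e$, and $(S^{\bowtie})^{ab}$ is a free $M$-module. -/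

import Mathlib

universe u v w w' w''

/-! ### Inverse monoids -/

/-- An inverse monoid: every element `a` has a unique inverse `a⁻¹`, in the sense of semigroup
theory. -/
class InverseMonoid (S : Type u) extends Monoid S, Inv S where
  mul_inv_mul : ∀ a : S, a * a⁻¹ * a = a
  inv_mul_inv : ∀ a : S, a⁻¹ * a * a⁻¹ = a⁻¹
  inv_unique : ∀ a b : S, a * b * a = a → b * a * b = b → b = a⁻¹

namespace InverseMonoid

variable {S : Type u} [InverseMonoid S]

theorem inv_inv' (a : S) : a⁻¹⁻¹ = a :=
  (inv_unique a⁻¹ a (inv_mul_inv a) (mul_inv_mul a)).symm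

theorem idem_inv {e : S} (he : e * e = e) : e⁻¹ = e :=
  (inv_unique e e (by rw [he, he]) (by rw [he, he])).symm

theorem idem_mul {e f : S} (he : e * e = e) (hf : f * f = f) : e * f * (e * f) = e * f := by
  have h1 := mul_inv_mul (e * f)
  have h2 := inv_mul_inv (e * f)
  generalize hx : (e * f)⁻¹ = x at h1 h2
  have hy : f * x * e = x := by
    rw [← hx]
    refine inv_unique _ _ ?_ ?_ <;> rw [hx]
    · calc e * f * (f * x * e) * (e * f) = e * (f * f) * x * (e * e) * f := by
            simp only [mul_assoc]
        _ = e * f * x * (e * f) := by rw [he, hf]; simp only [mul_assoc]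
        _ = e * f := h1
    · calc f * x * e * (e * f) * (f * x * e) = f * x * (e * e) * (f * f) * x * e := by
            simp only [mul_assoc]
        _ = f * (x * (e * f) * x) * e := by rw [he, hf]; simp only [mul_assoc]
        _ = f * x * e := by rw [h2]
  have hxx : x * x = x := by
    calc x * x = f * x * e * (f * x * e) := by rw [hy]
      _ = f * (x * (e * f) * x) * e := by simp only [mul_assoc]
      _ = x := by rw [h2, hy]
  have : e * f = x := by
    rw [← inv_inv' (e * f), hx, idem_inv hxx]
  rw [this, hxx]

theorem idem_comm {e f : S} (he : e * e = e) (hf : f * f = f) : e * f = f * e := by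
  have h1 := idem_mul he hf
  have h2 := idem_mul hf he
  have : f * e = (e * f)⁻¹ := by
    refine inv_unique _ _ ?_ ?_
    · calc e * f * (f * e) * (e * f) = e * (f * f) * (e * e) * f := by simp only [mul_assoc]
        _ = e * f * (e * f) := by rw [he, hf]; simp only [mul_assoc]
        _ = e * f := h1
    · calc f * e * (e * f) * (f * e) = f * (e * e) * (f * f) * e := by simp only [mul_assoc]
        _ = f * e * (f * e) := by rw [he, hf]; simp only [mul_assoc]
        _ = f * e := h2
  rw [this, idem_inv h1]

theorem inv_mul_idem (a : S) : a⁻¹ * a * (a⁻¹ * a) = a⁻¹ * a := by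
  rw [← mul_assoc, inv_mul_inv]

theorem mul_inv_idem (a : S) : a * a⁻¹ * (a * a⁻¹) = a * a⁻¹ := by
  rw [← mul_assoc, mul_inv_mul]

theorem mul_inv_rev' (a b : S) : (a * b)⁻¹ = b⁻¹ * a⁻¹ := by
  have hc := idem_comm (mul_inv_idem b) (inv_mul_idem a)
  refine (inv_unique _ _ ?_ ?_).symm
  · calc a * b * (b⁻¹ * a⁻¹) * (a * b) = a * (b * b⁻¹ * (a⁻¹ * a)) * b := by
          simp only [mul_assoc]
      _ = a * a⁻¹ * a * (b * b⁻¹ * b) := by rw [hc]; simp only [mul_assoc]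
      _ = a * b := by rw [mul_inv_mul, mul_inv_mul]
  · calc b⁻¹ * a⁻¹ * (a * b) * (b⁻¹ * a⁻¹) = b⁻¹ * (a⁻¹ * a * (b * b⁻¹)) * a⁻¹ := by
          simp only [mul_assoc]
      _ = b⁻¹ * b * b⁻¹ * (a⁻¹ * a * a⁻¹) := by rw [← hc]; simp only [mul_assoc]
      _ = b⁻¹ * a⁻¹ := by rw [inv_mul_inv, inv_mul_inv]

theorem map_inv' {N : Type v} [InverseMonoid N] (f : S →* N) (a : S) : f a⁻¹ = (f a)⁻¹ :=
  inv_unique _ _ (by rw [← map_mul, ← map_mul, mul_inv_mul])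
    (by rw [← map_mul, ← map_mul, inv_mul_inv])

theorem conj_idem {e : S} (he : e * e = e) (s : S) :
    s⁻¹ * e * s * (s⁻¹ * e * s) = s⁻¹ * e * s := by
  calc s⁻¹ * e * s * (s⁻¹ * e * s) = s⁻¹ * (e * (s * s⁻¹)) * e * s := by simp only [mul_assoc]
    _ = s⁻¹ * s * s⁻¹ * (e * e) * s := by
        rw [idem_comm he (mul_inv_idem s)]; simp only [mul_assoc]
    _ = s⁻¹ * e * s := by rw [inv_mul_inv, he]

/-- Inverse monoids form the variety of monoids with an involution given by these identities. -/
abbrev ofIdentities (S : Type u) [Monoid S] [Inv S] (h1 : ∀ a : S, a * a⁻¹ * a = a)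
    (h2 : ∀ a : S, a⁻¹⁻¹ = a) (h3 : ∀ a b : S, (a * b)⁻¹ = b⁻¹ * a⁻¹)
    (h4 : ∀ a b : S, a * a⁻¹ * (b * b⁻¹) = b * b⁻¹ * (a * a⁻¹)) : InverseMonoid S where
  mul_inv_mul := h1
  inv_mul_inv a := by simpa only [h2] using h1 a⁻¹
  inv_unique a b hab hba := by
    have h5 : ∀ a : S, a⁻¹ * a * a⁻¹ = a⁻¹ := fun a => by simpa only [h2] using h1 a⁻¹
    have key : ∀ e : S, e * e = e → e = e * e⁻¹ := by
      intro e he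
      have hi : e⁻¹ * e⁻¹ = e⁻¹ := by rw [← h3, he]
      have : e = e⁻¹ := by
        calc e = e * (e⁻¹ * e⁻¹) * e := by rw [hi, h1]
          _ = e * e⁻¹ * (e⁻¹ * e⁻¹⁻¹) := by rw [h2]; simp only [mul_assoc]
          _ = e⁻¹ * (e * e) * e⁻¹ := by rw [h4, h2]; simp only [mul_assoc]
          _ = e⁻¹ := by rw [he, h5]
      rw [← this, he]
    have comm : ∀ e f : S, e * e = e → f * f = f → e * f = f * e := by
      intro e f he hf
      rw [key e he, key f hf, h4]
    have i1 : a * b * (a * b) = a * b := by rw [← mul_assoc, hab]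
    have i2 : b * a * (b * a) = b * a := by rw [← mul_assoc, hba]
    have i3 : a * a⁻¹ * (a * a⁻¹) = a * a⁻¹ := by rw [← mul_assoc, h1]
    have i4 : a⁻¹ * a * (a⁻¹ * a) = a⁻¹ * a := by rw [← mul_assoc, h5]
    calc b = b * (a * a⁻¹ * a) * b := by rw [h1, hba]
      _ = b * (a * a⁻¹ * (a * b)) := by simp only [mul_assoc]
      _ = b * (a * b * (a * a⁻¹)) := by rw [comm _ _ i3 i1]
      _ = (b * a * b) * (a * a⁻¹) := by simp only [mul_assoc]
      _ = b * a * (a⁻¹ * a) * a⁻¹ := by rw [hba, mul_assoc b a, mul_assoc (b) _ a⁻¹, mul_assoc a, h5]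
      _ = a⁻¹ * (a * b * a) * a⁻¹ := by rw [comm _ _ i2 i4]; simp only [mul_assoc]
      _ = a⁻¹ := by rw [hab, h5]

/-- A monoid congruence on an inverse monoid is compatible with inversion. -/
theorem con_inv (c : Con S) {a b : S} (h : c a b) : c a⁻¹ b⁻¹ := by
  have e : (a : c.Quotient) = b := c.eq.2 h
  rw [← c.eq]
  have x1 : ((a⁻¹ : S) : c.Quotient) * a * (a⁻¹ : S) = (a⁻¹ : S) := by
    rw [← Con.coe_mul, ← Con.coe_mul, inv_mul_inv]
  have y1 : ((b⁻¹ : S) : c.Quotient) * a * (b⁻¹ : S) = (b⁻¹ : S) := by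
    rw [e, ← Con.coe_mul, ← Con.coe_mul, inv_mul_inv]
  have x2 : (a : c.Quotient) * (a⁻¹ : S) * a = a := by
    rw [← Con.coe_mul, ← Con.coe_mul, mul_inv_mul]
  have y2 : (a : c.Quotient) * (b⁻¹ : S) * a = a := by
    rw [e, ← Con.coe_mul, ← Con.coe_mul, mul_inv_mul]
  have c1 : (a : c.Quotient) * (b⁻¹ : S) * (a * (a⁻¹ : S)) = a * (a⁻¹ : S) * (a * (b⁻¹ : S)) := by
    have := idem_comm (mul_inv_idem b) (mul_inv_idem a)
    have := congrArg (fun s : S => (s : c.Quotient)) this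
    simp only [Con.coe_mul] at this
    rwa [← e] at this
  have c2 : ((a⁻¹ : S) : c.Quotient) * a * ((b⁻¹ : S) * a) = (b⁻¹ : S) * a * ((a⁻¹ : S) * a) := by
    have := idem_comm (inv_mul_idem a) (inv_mul_idem b)
    have := congrArg (fun s : S => (s : c.Quotient)) this
    simp only [Con.coe_mul] at this
    rwa [← e] at this
  generalize ((a⁻¹ : S) : c.Quotient) = x at *
  generalize ((b⁻¹ : S) : c.Quotient) = y at *
  generalize (a : c.Quotient) = z at *
  calc x = x * (z * y * z) * x := by rw [y2, x1]
    _ = x * (z * y * (z * x)) := by simp only [mul_assoc]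
    _ = x * z * x * (z * y) := by rw [c1]; simp only [mul_assoc]
    _ = x * z * (y * z * y) := by rw [x1, y1, mul_assoc]
    _ = x * z * (y * z) * y := by simp only [mul_assoc]
    _ = y * (z * x * z) * y := by rw [c2]; simp only [mul_assoc]
    _ = y := by rw [x2, y1]

instance (c : Con S) : Inv c.Quotient :=
  ⟨Quotient.map' (fun a => a⁻¹) fun _ _ h => con_inv c h⟩

/-- A quotient of an inverse monoid is an inverse monoid. -/
instance quotient (c : Con S) : InverseMonoid c.Quotient :=
  ofIdentities c.Quotient
    (by rintro ⟨a⟩; exact congrArg (fun s : S => (s : c.Quotient)) (mul_inv_mul a))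
    (by rintro ⟨a⟩; exact congrArg (fun s : S => (s : c.Quotient)) (inv_inv' a))
    (by rintro ⟨a⟩ ⟨b⟩; exact congrArg (fun s : S => (s : c.Quotient)) (mul_inv_rev' a b))
    (by
      rintro ⟨a⟩ ⟨b⟩
      exact congrArg (fun s : S => (s : c.Quotient)) (idem_comm (mul_inv_idem a) (mul_inv_idem b)))

end InverseMonoid

section Modules

open InverseMonoid

/-- The idempotents `E(S)` of an inverse monoid. -/
structure Idem (S : Type u) [InverseMonoid S] : Type u where
  val : S
  idem : val * val = val

namespace Idem

variable {S : Type u} [InverseMonoid S]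

attribute [ext] Idem

instance : Mul (Idem S) := ⟨fun e f => ⟨e.val * f.val, idem_mul e.idem f.idem⟩⟩

/-- The natural partial order on idempotents. -/
instance : LE (Idem S) := ⟨fun f e => f.val = e.val * f.val⟩

theorem le_def {e f : Idem S} : f ≤ e ↔ f.val = e.val * f.val := Iff.rfl

theorem coe_mul (e f : Idem S) : (e * f).val = e.val * f.val := rfl

protected theorem le_refl (e : Idem S) : e ≤ e := e.idem.symm

protected theorem le_trans {e f g : Idem S} (h1 : g ≤ f) (h2 : f ≤ e) : g ≤ e := by
  rw [le_def] at *
  rw [h1, ← mul_assoc, ← h2]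

theorem mul_le_left (e f : Idem S) : e * f ≤ e := by
  rw [le_def, coe_mul, ← mul_assoc, e.idem]

theorem mul_le_right (e f : Idem S) : e * f ≤ f := by
  rw [le_def, coe_mul, idem_comm e.idem f.idem, ← mul_assoc, f.idem]

/-- The idempotent `s⁻¹es`. -/
def conj (e : Idem S) (s : S) : Idem S := ⟨s⁻¹ * e.val * s, conj_idem e.idem s⟩

/-- The idempotent `ss⁻¹`. -/
def dom (s : S) : Idem S := ⟨s * s⁻¹, mul_inv_idem s⟩

/-- The idempotent `s⁻¹s`. -/
def ran (s : S) : Idem S := ⟨s⁻¹ * s, inv_mul_idem s⟩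

end Idem

/-! ### Lausch modules -/

/-- A presheaf of abelian groups over the semilattice `E(S)`. -/
structure AbPresheaf (S : Type u) [InverseMonoid S] where
  carrier : Idem S → Type w
  grp : ∀ e, AddCommGroup (carrier e)
  res : ∀ {e f : Idem S}, f ≤ e → carrier e →+ carrier f
  res_self : ∀ {e : Idem S} (h : e ≤ e) (a : carrier e), res h a = a
  res_res : ∀ {e f g : Idem S} (h1 : f ≤ e) (h2 : g ≤ f) (h3 : g ≤ e) (a : carrier e),
    res h2 (res h1 a) = res h3 a

attribute [instance] AbPresheaf.grp

namespace AbPresheaf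

variable {S : Type u} [InverseMonoid S] (A : AbPresheaf.{u, w} S)

/-- The disjoint union of the groups `A_e`. -/
abbrev Total : Type (max u w) := Σ e : Idem S, A.carrier e

/-- The operation `a ⊕ b` of the commutative Clifford semigroup `⊔ A_e`. -/
def oplus (a b : A.Total) : A.Total :=
  ⟨a.1 * b.1, A.res (Idem.mul_le_left a.1 b.1) a.2 + A.res (Idem.mul_le_right a.1 b.1) b.2⟩

/-- The element `0_e`. -/
def zeroAt (e : Idem S) : A.Total := ⟨e, 0⟩

end AbPresheaf

/-- A module, in the sense of Lausch, for an inverse monoid `S`. -/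
structure LauschModule (S : Type u) [InverseMonoid S] extends AbPresheaf.{u, w} S where
  act : toAbPresheaf.Total → S → toAbPresheaf.Total
  act_oplus : ∀ a b s,
    act (toAbPresheaf.oplus a b) s = toAbPresheaf.oplus (act a s) (act b s)
  act_mul : ∀ a s t, act a (s * t) = act (act a s) t
  act_idem : ∀ a (e : Idem S), act a e.val = toAbPresheaf.oplus a (toAbPresheaf.zeroAt e)
  act_zero : ∀ e s, act (toAbPresheaf.zeroAt e) s = toAbPresheaf.zeroAt (e.conj s)

namespace LauschModule

variable {S : Type u} [InverseMonoid S]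

/-- A homomorphism of `S`-modules: homomorphisms `A_e → B_e` that commute with the structure maps
and with the action of `S`. -/
structure Hom (A : LauschModule.{u, w} S) (B : LauschModule.{u, w'} S) where
  app : ∀ e, A.carrier e →+ B.carrier e
  map_res : ∀ {e f : Idem S} (h : f ≤ e) (a : A.carrier e),
    app f (A.res h a) = B.res h (app e a)
  map_act : ∀ (a : A.toAbPresheaf.Total) (s : S),
    (⟨(A.act a s).1, app _ (A.act a s).2⟩ : B.toAbPresheaf.Total) = B.act ⟨a.1, app _ a.2⟩ s

/-- Two modules are isomorphic if there is a homomorphism between them that is bijective. -/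
def Isomorphic (A : LauschModule.{u, w} S) (B : LauschModule.{u, w'} S) : Prop :=
  ∃ φ : Hom A B, ∀ e, Function.Bijective (φ.app e)

/-- Exactness of `0 → A → B → C → 0`. -/
structure ShortExact {A : LauschModule.{u, w} S} {B : LauschModule.{u, w'} S}
    {C : LauschModule.{u, v} S} (f : Hom A B) (g : Hom B C) : Prop where
  injective : ∀ e, Function.Injective (f.app e)
  exact : ∀ e, Function.Exact (f.app e) (g.app e)
  surjective : ∀ e, Function.Surjective (g.app e)

end LauschModule

/-- The action of `S` on a Lausch module, written as a family of homomorphisms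
`A_e → A_f`, where `f = s⁻¹es`. The structure maps are then given by the action of idempotents. -/
structure GradedAction (S : Type u) [InverseMonoid S] (A : Idem S → Type w)
    [∀ e, AddCommGroup (A e)] where
  act : ∀ (s : S) {e f : Idem S}, f.val = s⁻¹ * e.val * s → (A e →+ A f)
  act_mul : ∀ (s t : S) {e f g : Idem S} (h1 : f.val = s⁻¹ * e.val * s) (h2 : g.val = t⁻¹ * f.val * t)
    (h3 : g.val = (s * t)⁻¹ * e.val * (s * t)) (a : A e), act (s * t) h3 a = act t h2 (act s h1 a)
  act_self : ∀ (e : Idem S) (h : e.val = e.val⁻¹ * e.val * e.val) (a : A e), act e.val h a = a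

namespace GradedAction

variable {S : Type u} [InverseMonoid S] {A : Idem S → Type w} [∀ e, AddCommGroup (A e)]

theorem le_conj {e f : Idem S} (h : f ≤ e) : f.val = f.val⁻¹ * e.val * f.val := by
  rw [idem_inv f.idem, mul_assoc, ← Idem.le_def.1 h, f.idem]

theorem act_congr (α : GradedAction S A) {s t : S} (hst : s = t) {e f f' : Idem S} (hf : f = f')
    (h : f.val = s⁻¹ * e.val * s) (h' : f'.1 = t⁻¹ * e.val * t) (a : A e) :
    (⟨f, α.act s h a⟩ : Σ e, A e) = ⟨f', α.act t h' a⟩ := by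
  subst hst hf; rfl

theorem act_of_eq (α : GradedAction S A) {s t : S} {e f : Idem S} (hst : e.val * s = e.val * t)
    (h : f.val = s⁻¹ * e.val * s) (h' : f.val = t⁻¹ * e.val * t) (a : A e) :
    α.act s h a = α.act t h' a := by
  have he : e.val = e.val⁻¹ * e.val * e.val := by rw [idem_inv e.idem, e.idem, e.idem]
  have key : ∀ (r : S) (hr : f.val = r⁻¹ * e.val * r) (hr' : f.val = (e.val * r)⁻¹ * e.val * (e.val * r)),
      α.act r hr a = α.act (e.val * r) hr' a := by
    intro r hr hr'
    rw [α.act_mul e.val r he hr hr', α.act_self]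
  have h2 : ∀ (r : S) (hr : f.val = r⁻¹ * e.val * r), f.val = (e.val * r)⁻¹ * e.val * (e.val * r) := by
    intro r hr
    rw [hr, mul_inv_rev', idem_inv e.idem]
    calc r⁻¹ * e.val * r = r⁻¹ * (e.val * e.val * e.val) * r := by rw [e.idem, e.idem]
      _ = _ := by simp only [mul_assoc]
  rw [key s h (h2 s h), key t h' (h2 t h')]
  have := α.act_congr hst rfl (h2 s h) (h2 t h') a
  simpa only [Sigma.mk.injEq, heq_eq_eq, true_and] using this

theorem conj_mul (e f : Idem S) (s : S) : (e * f).conj s = e.conj s * f.conj s := by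
  ext
  simp only [Idem.conj, Idem.coe_mul]
  calc s⁻¹ * (e.val * f.val) * s = s⁻¹ * s * s⁻¹ * e.val * f.val * s := by
        rw [inv_mul_inv]; simp only [mul_assoc]
    _ = s⁻¹ * (s * s⁻¹ * e.val) * f.val * s := by simp only [mul_assoc]
    _ = _ := by rw [idem_comm (mul_inv_idem s) e.idem]; simp only [mul_assoc]

theorem act_res (α : GradedAction S A) {e f g g' : Idem S} (h : g ≤ e) (s : S)
    (hf : f.val = s⁻¹ * e.val * s) (h' : g' ≤ f) (hg : g'.val = s⁻¹ * g.val * s) (a : A e) :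
    α.act s hg (α.act g.val (le_conj h) a) = α.act g'.val (le_conj h') (α.act s hf a) := by
  have hs : s * g'.val = g.val * s := by
    rw [hg]
    calc s * (s⁻¹ * g.val * s) = s * s⁻¹ * g.val * s := by simp only [mul_assoc]
      _ = _ := by rw [idem_comm (mul_inv_idem s) g.idem, mul_assoc, mul_inv_mul]
  have h1 : g'.val = (g.val * s)⁻¹ * e.val * (g.val * s) := by
    rw [mul_inv_rev', hg]
    conv_lhs => rw [le_conj h]
    simp only [mul_assoc]
  rw [← α.act_mul _ _ _ _ h1, ← α.act_mul _ _ _ _ (by rw [hs]; exact h1)]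
  exact α.act_of_eq (by rw [hs]) _ _ a

/-- The Lausch module given by a graded action. -/
def toModule (α : GradedAction S A) : LauschModule.{u, w} S where
  carrier := A
  grp := inferInstance
  res {e f} h := α.act f.val (le_conj h)
  res_self {e} _ a := α.act_self e _ a
  res_res {e f g} h1 h2 h3 a := by
    rw [← α.act_mul f.val g.val (le_conj h1) (le_conj h2)]
    · refine α.act_of_eq ?_ _ _ a
      rw [← h2]
    · rw [← Idem.le_def.1 h2]; exact le_conj h3
  act a s := ⟨a.1.conj s, α.act s rfl a.2⟩
  act_oplus := by
    rintro ⟨e, a⟩ ⟨f, b⟩ s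
    have gen : ∀ (g : Idem S) (_ : g = e.conj s * f.conj s) (h0 : g.val = s⁻¹ * (e * f).val * s),
        (⟨g, α.act s h0 (α.act (e * f).val (le_conj (Idem.mul_le_left e f)) a +
            α.act (e * f).val (le_conj (Idem.mul_le_right e f)) b)⟩ : Σ e, A e) =
          ⟨e.conj s * f.conj s,
            α.act (e.conj s * f.conj s).val (le_conj (Idem.mul_le_left _ _)) (α.act s rfl a) +
            α.act (e.conj s * f.conj s).val (le_conj (Idem.mul_le_right _ _)) (α.act s rfl b)⟩ := by
      intro g hg h0
      subst hg
      rw [map_add, α.act_res (Idem.mul_le_left e f) s rfl (Idem.mul_le_left _ _) h0,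
        α.act_res (Idem.mul_le_right e f) s rfl (Idem.mul_le_right _ _) h0]
    exact gen _ (conj_mul e f s) rfl
  act_mul := by
    rintro ⟨e, a⟩ s t
    have hE : e.conj (s * t) = (e.conj s).conj t := by
      ext; simp only [Idem.conj, mul_inv_rev', mul_assoc]
    have h3 : ((e.conj s).conj t).1 = (s * t)⁻¹ * e.val * (s * t) := by rw [← hE]; rfl
    change (⟨e.conj (s * t), α.act (s * t) rfl a⟩ : Σ e, A e) =
      ⟨(e.conj s).conj t, α.act t rfl (α.act s rfl a)⟩
    rw [← α.act_mul s t rfl rfl h3]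
    exact α.act_congr rfl hE _ _ a
  act_idem := by
    rintro ⟨e, a⟩ f
    have hE : e.conj f.val = e * f := by
      ext
      simp only [Idem.conj, Idem.coe_mul]
      rw [idem_inv f.idem, idem_comm f.idem e.idem, mul_assoc, f.idem]
    have h' : (e * f).val = f.val⁻¹ * e.val * f.val := by rw [← hE]; rfl
    change (⟨e.conj f.val, α.act f.val rfl a⟩ : Σ e, A e) =
      ⟨e * f, α.act (e * f).val (le_conj (Idem.mul_le_left e f)) a +
        α.act (e * f).val (le_conj (Idem.mul_le_right e f)) 0⟩
    rw [map_zero, add_zero,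
      α.act_of_eq (t := f.val) (by rw [Idem.coe_mul, ← mul_assoc, e.idem]) _ h' a]
    exact α.act_congr rfl hE _ _ a
  act_zero := by
    intro e s
    change (⟨e.conj s, α.act s rfl 0⟩ : Σ e, A e) = ⟨e.conj s, 0⟩
    rw [map_zero]

end GradedAction

namespace LauschModule

variable {S : Type u} [InverseMonoid S]

/-- The basis `{(b, s) : b ∈ B_f, f ≥ ss⁻¹, s⁻¹s = e}` of the group `F_e` of the free module on
the family of sets `B`. -/
@[ext] structure FreeBasis (B : Idem S → Type w) (e : Idem S) : Type (max u w) where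
  gen : Σ f : Idem S, B f
  elt : S
  dom_le : Idem.dom elt ≤ gen.1
  ran_eq : Idem.ran elt = e

/-- The map `(b, s) ↦ (b, st)`. -/
def FreeBasis.act {B : Idem S → Type w} (t : S) {e f : Idem S} (h : f.val = t⁻¹ * e.val * t)
    (x : FreeBasis B e) : FreeBasis B f where
  gen := x.gen
  elt := x.elt * t
  dom_le := by
    refine Idem.le_trans (f := Idem.dom x.elt) ?_ x.dom_le
    rw [Idem.le_def]
    simp only [Idem.dom]
    rw [← mul_assoc, ← mul_assoc, mul_inv_mul]
  ran_eq := by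
    ext
    have hv : e.val = x.elt⁻¹ * x.elt := congrArg Idem.val x.ran_eq.symm
    rw [h, hv]
    simp only [Idem.ran, mul_inv_rev', mul_assoc]

/-- The action of the free module: `(b, s) ◁ t = (b, st)`. -/
def freeAction (B : Idem S → Type w) :
    GradedAction S fun e => FreeAbelianGroup (FreeBasis B e) where
  act t {_ _} h := FreeAbelianGroup.map (FreeBasis.act t h)
  act_mul s t {e f g} h1 h2 h3 a := by
    rw [← FreeAbelianGroup.map_comp_apply]
    congr 2
    funext x
    exact FreeBasis.ext rfl (mul_assoc _ _ _).symm
  act_self e h a := by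
    have : FreeBasis.act (B := B) e.val h = id := by
      funext x
      refine FreeBasis.ext rfl ?_
      change x.elt * e.val = x.elt
      have hv : e.val = x.elt⁻¹ * x.elt := congrArg Idem.val x.ran_eq.symm
      rw [hv, ← mul_assoc, mul_inv_mul]
    rw [this, FreeAbelianGroup.map_id_apply]

/-- The free `S`-module on the family of sets `B`. -/
def free (B : Idem S → Type w) : LauschModule.{u, max u w} S := (freeAction B).toModule

/-- A module is free if it is isomorphic to the free module on some family of sets. -/
def IsFree (A : LauschModule.{u, w'} S) : Prop :=
  ∃ B : Idem S → Type w, Isomorphic A (free B)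

end LauschModule

/-! ### The free inverse monoid -/

/-- The inverse of a word over the alphabet `A = X ⊔ X⁻¹`, where `(x, true)` is the letter `x` and
`(x, false)` is the letter `x⁻¹`. -/
def invWord {X : Type u} (w : FreeMonoid (X × Bool)) : FreeMonoid (X × Bool) :=
  FreeMonoid.ofList (FreeGroup.invRev (FreeMonoid.toList w))

theorem invWord_mul {X : Type u} (v w : FreeMonoid (X × Bool)) :
    invWord (v * w) = invWord w * invWord v :=
  FreeGroup.invRev_append

theorem invWord_invWord {X : Type u} (w : FreeMonoid (X × Bool)) : invWord (invWord w) = w :=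
  FreeGroup.invRev_invRev

/-- The defining relations of the Wagner congruence. -/
inductive WagnerRel (X : Type u) : FreeMonoid (X × Bool) → FreeMonoid (X × Bool) → Prop
  | regular (w : FreeMonoid (X × Bool)) : WagnerRel X (w * invWord w * w) w
  | commute (v w : FreeMonoid (X × Bool)) :
      WagnerRel X (v * invWord v * (w * invWord w)) (w * invWord w * (v * invWord v))

/-- The Wagner congruence on the free monoid on `X ⊔ X⁻¹`. -/
def wagnerCon (X : Type u) : Con (FreeMonoid (X × Bool)) := conGen (WagnerRel X)

theorem wagnerCon_inv {X : Type u} {v w : FreeMonoid (X × Bool)} (h : wagnerCon X v w) :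
    wagnerCon X (invWord v) (invWord w) := by
  have h' : ConGen.Rel (WagnerRel X) v w := h
  change ConGen.Rel (WagnerRel X) (invWord v) (invWord w)
  induction h' with
  | of x y hxy =>
    cases hxy with
    | regular =>
      have := ConGen.Rel.of _ _ (WagnerRel.regular (invWord y))
      simpa only [invWord_mul, invWord_invWord, mul_assoc] using this
    | commute a b =>
      have := ConGen.Rel.of _ _ (WagnerRel.commute b a)
      simpa only [invWord_mul, invWord_invWord, mul_assoc] using this
  | refl x => exact ConGen.Rel.refl _
  | symm h1 ih => exact (ih h1).symm
  | trans h1 h2 ih1 ih2 => exact (ih1 h1).trans (ih2 h2)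
  | mul h1 h2 ih1 ih2 =>
    rw [invWord_mul, invWord_mul]
    exact (ih2 h2).mul (ih1 h1)

/-- The free inverse monoid on `X`. -/
def FIM (X : Type u) : Type u := (wagnerCon X).Quotient

namespace FIM

instance (X : Type u) : Monoid (FIM X) := inferInstanceAs (Monoid (wagnerCon X).Quotient)

instance (X : Type u) : Inv (FIM X) :=
  ⟨Quotient.map' (s₁ := (wagnerCon X).toSetoid) (s₂ := (wagnerCon X).toSetoid) invWord
    fun _ _ h => wagnerCon_inv h⟩

/-- The canonical map `ρ` from words to the free inverse monoid. -/
def ofWord {X : Type u} : FreeMonoid (X × Bool) →* FIM X := (wagnerCon X).mk'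

theorem ofWord_surjective {X : Type u} : Function.Surjective (ofWord (X := X)) :=
  (wagnerCon X).mk'_surjective

theorem ofWord_inv {X : Type u} (w : FreeMonoid (X × Bool)) : (ofWord w)⁻¹ = ofWord (invWord w) :=
  rfl

theorem ofWord_eq {X : Type u} {v w : FreeMonoid (X × Bool)} (h : WagnerRel X v w) :
    ofWord v = ofWord w :=
  (wagnerCon X).eq.2 (ConGen.Rel.of _ _ h)

instance (X : Type u) : InverseMonoid (FIM X) :=
  ofIdentities (FIM X)
    (fun a => by
      obtain ⟨w, rfl⟩ := ofWord_surjective a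
      rw [ofWord_inv, ← map_mul, ← map_mul]
      exact ofWord_eq (.regular w))
    (fun a => by
      obtain ⟨w, rfl⟩ := ofWord_surjective a
      rw [ofWord_inv, ofWord_inv, invWord_invWord])
    (fun a b => by
      obtain ⟨v, rfl⟩ := ofWord_surjective a
      obtain ⟨w, rfl⟩ := ofWord_surjective b
      rw [← map_mul, ofWord_inv, ofWord_inv, ofWord_inv, invWord_mul, map_mul])
    (fun a b => by
      obtain ⟨v, rfl⟩ := ofWord_surjective a
      obtain ⟨w, rfl⟩ := ofWord_surjective b
      simp only [ofWord_inv, ← map_mul]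
      exact ofWord_eq (.commute v w))

end FIM

/-! ### The minimal congruence with the trace of a given homomorphism -/

section MinCon

variable {S : Type u} {M : Type v} [InverseMonoid S] [InverseMonoid M] (θ : S →* M)

/-- `a` and `b` are related if there is an idempotent `e` with `ae = be` whose image under `θ` is
the image of `a⁻¹a` and of `b⁻¹b`. -/
def MinRel (a b : S) : Prop :=
  ∃ e : Idem S, a * e.val = b * e.val ∧ θ (a⁻¹ * a) = θ e.val ∧ θ e.val = θ (b⁻¹ * b)

theorem MinRel.map_eq {θ : S →* M} {a b : S} (h : MinRel θ a b) : θ a = θ b := by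
  obtain ⟨e, h1, h2, h3⟩ := h
  calc θ a = θ (a * (a⁻¹ * a)) := by rw [← mul_assoc, mul_inv_mul]
    _ = θ (b * e.val) := by rw [map_mul, h2, ← map_mul, h1]
    _ = θ (b * (b⁻¹ * b)) := by rw [map_mul, h3, ← map_mul]
    _ = θ b := by rw [← mul_assoc, mul_inv_mul]

/-- The smallest congruence `θ_min` with the same trace as the congruence induced by `θ`. -/
def minCon : Con S where
  r := MinRel θ
  iseqv :=
    { refl := fun a => ⟨Idem.ran a, rfl, rfl, rfl⟩
      symm := fun ⟨e, h1, h2, h3⟩ => ⟨e, h1.symm, h3.symm, h2.symm⟩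
      trans := by
        rintro a b c ⟨e, h1, h2, h3⟩ ⟨f, k1, k2, k3⟩
        have hef : θ (e * f).val = θ e.val := by
          rw [Idem.coe_mul, map_mul, ← k2, ← h3, ← map_mul, e.idem]
        refine ⟨e * f, ?_, ?_, ?_⟩
        · rw [Idem.coe_mul, ← mul_assoc, h1, mul_assoc, idem_comm e.idem f.idem, ← mul_assoc, k1,
            mul_assoc]
        · rw [hef, h2]
        · rw [hef, h3, k2, k3] }
  mul' := by
    rintro a b c d hab hcd
    have hθ : θ c = θ d := hcd.map_eq
    have hθ' : θ a = θ b := hab.map_eq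
    obtain ⟨e, h1, h2, h3⟩ := hab
    obtain ⟨f, k1, k2, k3⟩ := hcd
    have hg : c * (e.conj c * f).val = e.val * c * f.val := by
      calc c * (c⁻¹ * e.val * c * f.val) = c * c⁻¹ * e.val * c * f.val := by
            simp only [mul_assoc]
        _ = e.val * (c * c⁻¹ * c) * f.val := by
            rw [idem_comm (mul_inv_idem c) e.idem]; simp only [mul_assoc]
        _ = _ := by rw [mul_inv_mul]
    have hg' : d * (e.conj c * f).val = e.val * c * f.val := by
      rw [Idem.coe_mul, idem_comm (e.conj c).idem f.idem, ← mul_assoc, ← k1, mul_assoc,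
        idem_comm f.idem (e.conj c).idem, ← Idem.coe_mul, hg]
    have hv : θ (e.conj c * f).val = θ ((a * c)⁻¹ * (a * c)) := by
      rw [mul_inv_rev']
      calc θ (c⁻¹ * e.val * c * f.val) = θ c⁻¹ * θ (a⁻¹ * a) * θ (c * (c⁻¹ * c)) := by
            simp only [map_mul, ← k2, ← h2, mul_assoc]
        _ = _ := by
            rw [← mul_assoc c, mul_inv_mul]; simp only [map_mul, mul_assoc]
    refine ⟨e.conj c * f, ?_, hv.symm, ?_⟩
    · rw [mul_assoc a, hg, mul_assoc b, hg', mul_assoc e.val, ← mul_assoc a, ← mul_assoc b, h1]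
    · rw [hv]
      simp only [map_mul, map_inv', hθ, hθ']

end MinCon

/-! ### Presentations of inverse monoids -/

/-- A presentation of the inverse monoid `M` with generating set `X`: a set of pairs of words over
`X ⊔ X⁻¹` and a surjective homomorphism from the free inverse monoid to `M` that induces the
congruence generated by these pairs. -/
structure InvPresentation (X : Type u) (M : Type v) [InverseMonoid M] where
  rels : Set (FreeMonoid (X × Bool) × FreeMonoid (X × Bool))
  θ : FIM X →* M
  surjective : Function.Surjective θ
  ker_eq : Con.ker θ =
    conGen fun a b => ∃ p ∈ rels, a = FIM.ofWord p.1 ∧ b = FIM.ofWord p.2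

/-- An idempotent separating quotient map `ψ : T → M` of inverse monoids, together with a family of
relations `lhs i = rhs i` between elements of `T` that generates the congruence of `ψ`. -/
structure SepQuotient (ι : Type w) (T : Type u) (M : Type v) [InverseMonoid T]
    [InverseMonoid M] where
  ψ : T →* M
  surjective : Function.Surjective ψ
  separating : ∀ e f : Idem T, ψ e.val = ψ f.val → e = f
  lhs : ι → T
  rhs : ι → T
  ker_eq : Con.ker ψ = conGen fun a b => ∃ i, a = lhs i ∧ b = rhs i

namespace InvPresentation

variable {X : Type u} {M : Type v} [InverseMonoid M] (P : InvPresentation X M)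

/-- The inverse monoid `𝒯(M, X) = FIM(X) / θ_min`. -/
abbrev T : Type u := (minCon P.θ).Quotient

/-- The map `τ : FIM(X) → 𝒯(M, X)`. -/
def τ : FIM X →* P.T := (minCon P.θ).mk'

/-- The idempotent separating map `ψ : 𝒯(M, X) → M`. -/
def ψ : P.T →* M := (minCon P.θ).lift P.θ fun _ _ h => MinRel.map_eq h

theorem τ_surjective : Function.Surjective P.τ := (minCon P.θ).mk'_surjective

theorem ψ_τ (a : FIM X) : P.ψ (P.τ a) = P.θ a := rfl

/-- The map `ψ : 𝒯(M, X) → M` and the relations of the presentation, read in `𝒯(M, X)`. -/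
def sep : SepQuotient P.rels P.T M where
  ψ := P.ψ
  surjective m := by
    obtain ⟨a, rfl⟩ := P.surjective m
    exact ⟨P.τ a, rfl⟩
  separating := by
    have key : ∀ e : Idem P.T, ∃ a : FIM X, e.val = P.τ (a⁻¹ * a) := by
      intro e
      obtain ⟨a, ha⟩ := P.τ_surjective e.val
      refine ⟨a, ?_⟩
      rw [map_mul, map_inv', ha, idem_inv e.idem, e.idem]
    intro e f h
    obtain ⟨a, ha⟩ := key e
    obtain ⟨b, hb⟩ := key f
    have hab : P.θ (a⁻¹ * a) = P.θ (b⁻¹ * b) := by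
      rw [ha, hb, P.ψ_τ, P.ψ_τ] at h; exact h
    ext
    rw [ha, hb]
    refine (minCon P.θ).eq.2 ?_
    have ia : (a⁻¹ * a)⁻¹ * (a⁻¹ * a) = a⁻¹ * a := by rw [idem_inv (inv_mul_idem a), inv_mul_idem]
    have ib : (b⁻¹ * b)⁻¹ * (b⁻¹ * b) = b⁻¹ * b := by rw [idem_inv (inv_mul_idem b), inv_mul_idem]
    refine ⟨Idem.ran a * Idem.ran b, ?_, ?_, ?_⟩
    · simp only [Idem.coe_mul, Idem.ran]
      rw [← mul_assoc (a⁻¹ * a) (a⁻¹ * a), inv_mul_idem,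
        idem_comm (inv_mul_idem a) (inv_mul_idem b),
        ← mul_assoc (b⁻¹ * b) (b⁻¹ * b), inv_mul_idem]
    · rw [ia, Idem.coe_mul]
      simp only [Idem.ran]
      rw [map_mul P.θ (a⁻¹ * a), ← hab, ← map_mul, inv_mul_idem]
    · rw [ib, Idem.coe_mul]
      simp only [Idem.ran]
      rw [map_mul P.θ (a⁻¹ * a), hab, ← map_mul, inv_mul_idem]
  lhs p := P.τ (FIM.ofWord p.1.1)
  rhs p := P.τ (FIM.ofWord p.1.2)
  ker_eq := by
    refine le_antisymm ?_ ?_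
    · intro x y h
      obtain ⟨a, rfl⟩ := P.τ_surjective x
      obtain ⟨b, rfl⟩ := P.τ_surjective y
      have hab : Con.ker P.θ a b := h
      rw [P.ker_eq] at hab
      have hle : (conGen fun a b => ∃ p ∈ P.rels, a = FIM.ofWord p.1 ∧ b = FIM.ofWord p.2) ≤
          Con.comap P.τ P.τ.map_mul (conGen fun a b => ∃ p : P.rels,
            a = P.τ (FIM.ofWord p.1.1) ∧ b = P.τ (FIM.ofWord p.1.2)) := by
        rw [Con.conGen_le]
        rintro _ _ ⟨p, hp, rfl, rfl⟩
        exact ConGen.Rel.of _ _ ⟨⟨p, hp⟩, rfl, rfl⟩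
      exact hle hab
    · rw [Con.conGen_le]
      rintro _ _ ⟨p, rfl, rfl⟩
      change P.θ (FIM.ofWord p.1.1) = P.θ (FIM.ofWord p.1.2)
      have : Con.ker P.θ (FIM.ofWord p.1.1) (FIM.ofWord p.1.2) := by
        rw [P.ker_eq]
        exact ConGen.Rel.of _ _ ⟨p.1, p.2, rfl, rfl⟩
      exact this

end InvPresentation

namespace SepQuotient

variable {ι : Type w} {T : Type u} {M : Type v} [InverseMonoid T] [InverseMonoid M]
  (Q : SepQuotient ι T M)

theorem idem_eq {a b : T} (ha : a * a = a) (hb : b * b = b) (h : Q.ψ a = Q.ψ b) : a = b :=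
  congrArg Idem.val (Q.separating ⟨a, ha⟩ ⟨b, hb⟩ h)

theorem mul_inv_eq {a b : T} (h : Q.ψ a = Q.ψ b) : a * a⁻¹ = b * b⁻¹ :=
  Q.idem_eq (mul_inv_idem a) (mul_inv_idem b) (by simp only [map_mul, map_inv', h])

theorem inv_mul_eq {a b : T} (h : Q.ψ a = Q.ψ b) : a⁻¹ * a = b⁻¹ * b :=
  Q.idem_eq (inv_mul_idem a) (inv_mul_idem b) (by simp only [map_mul, map_inv', h])

theorem mul_inv_of_ker {e : Idem T} {a : T} (h : Q.ψ a = Q.ψ e.val) : a * a⁻¹ = e.val := by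
  rw [Q.mul_inv_eq h, idem_inv e.idem, e.idem]

theorem inv_mul_of_ker {e : Idem T} {a : T} (h : Q.ψ a = Q.ψ e.val) : a⁻¹ * a = e.val := by
  rw [Q.inv_mul_eq h, idem_inv e.idem, e.idem]

theorem idem_mul_of_ker {e : Idem T} {a : T} (h : Q.ψ a = Q.ψ e.val) : e.val * a = a := by
  rw [← Q.mul_inv_of_ker h, mul_inv_mul]

theorem mul_idem_of_ker {e : Idem T} {a : T} (h : Q.ψ a = Q.ψ e.val) : a * e.val = a := by
  rw [← Q.inv_mul_of_ker h, ← mul_assoc, mul_inv_mul]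

theorem ker_comm {e : Idem T} {a : T} (h : Q.ψ a = Q.ψ e.val) {f : T}
    (hf : f * f = f) : a * f = f * a := by
  have h1 : a * f * a⁻¹ = e.val * f := by
    refine Q.idem_eq ?_ (idem_mul e.idem hf) ?_
    · have := conj_idem hf a⁻¹
      rwa [inv_inv'] at this
    · have : e.val * f * e.val = e.val * f := by
        rw [mul_assoc, ← idem_comm e.idem hf, ← mul_assoc, e.idem]
      rw [← this]
      simp only [map_mul, map_inv', h]
      rw [← map_inv', idem_inv e.idem]
  calc a * f = a * (a⁻¹ * a * f) := by rw [← mul_assoc, ← mul_assoc, mul_inv_mul]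
    _ = a * f * a⁻¹ * a := by rw [idem_comm (inv_mul_idem a) hf]; simp only [mul_assoc]
    _ = f * a := by rw [h1, idem_comm e.idem hf, mul_assoc, Q.idem_mul_of_ker h]

/-- The unique idempotent of `T` over an idempotent of `M`. -/
noncomputable def lift (e : Idem M) : Idem T := Idem.ran (Classical.choose (Q.surjective e.val))

theorem ψ_lift (e : Idem M) : Q.ψ (Q.lift e).val = e.val := by
  change Q.ψ ((Classical.choose (Q.surjective e.val))⁻¹ * _) = _
  rw [map_mul, map_inv', Classical.choose_spec (Q.surjective e.val), idem_inv e.idem, e.idem]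

/-- A chosen element of `T` over an element of `M`. -/
noncomputable def pick (m : M) : T := Classical.choose (Q.surjective m)

theorem ψ_pick (m : M) : Q.ψ (Q.pick m) = m := Classical.choose_spec (Q.surjective m)

/-- A `T`-action that depends only on the images in `M` of the elements of `T` makes the groups
`A_e`, indexed by the idempotents of `M`, into an `M`-module, in which `a ◁ m = a ◁ t` for any `t`
over `m`. -/
noncomputable def descend {A : Idem T → Type w'} [∀ e, AddCommGroup (A e)] (α : GradedAction T A)
    (hα : ∀ (s t : T) {e f : Idem T} (hs : f.val = s⁻¹ * e.val * s) (ht : f.val = t⁻¹ * e.val * t),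
      Q.ψ s = Q.ψ t → ∀ a : A e, α.act s hs a = α.act t ht a) :
    GradedAction M fun e => A (Q.lift e) :=
  have key : ∀ (m : M) (t : T) (_ : Q.ψ t = m) {e f : Idem M} (_ : f.val = m⁻¹ * e.val * m),
      (Q.lift f).val = t⁻¹ * (Q.lift e).val * t := by
    intro m t ht e f h
    refine Q.idem_eq (Q.lift f).idem (conj_idem (Q.lift e).idem t) ?_
    rw [map_mul, map_mul, map_inv', ht, Q.ψ_lift, Q.ψ_lift, h]
  { act := fun m {_ _} h => α.act (Q.pick m) (key m _ (Q.ψ_pick m) h)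
    act_mul := by
      intro s t e f g h1 h2 h3 a
      rw [← α.act_mul _ _ _ _ (key (s * t) _ (by rw [map_mul, Q.ψ_pick, Q.ψ_pick]) h3)]
      exact hα _ _ _ _ (by rw [map_mul, Q.ψ_pick, Q.ψ_pick, Q.ψ_pick]) a
    act_self := by
      intro e h a
      exact (hα _ _ _ (key e.val _ (Q.ψ_lift e) h) (by rw [Q.ψ_pick, Q.ψ_lift]) a).trans
        (α.act_self (Q.lift e) _ a) }

/-! ### The relation module -/

/-- The group `K_e` of elements of `T` with the same image in `M` as the idempotent `e`. -/
@[ext] structure Ker (e : Idem T) : Type u where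
  val : T
  ψ_val : Q.ψ val = Q.ψ e.val

namespace Ker

variable {Q} {e : Idem T}

instance : Mul (Ker Q e) :=
  ⟨fun a b => ⟨a.val * b.val, by rw [map_mul, a.ψ_val, b.ψ_val, ← map_mul, e.idem]⟩⟩

instance : One (Ker Q e) := ⟨⟨e.val, rfl⟩⟩

instance : Inv (Ker Q e) :=
  ⟨fun a => ⟨a.val⁻¹, by rw [map_inv', a.ψ_val, ← map_inv', idem_inv e.idem]⟩⟩

instance : Group (Ker Q e) :=
  Group.ofLeftAxioms (fun a b c => Ker.ext (mul_assoc a.val b.val c.val))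
    (fun a => Ker.ext (Q.idem_mul_of_ker a.ψ_val)) (fun a => Ker.ext (Q.inv_mul_of_ker a.ψ_val))

/-- Conjugation `k ↦ t⁻¹kt`. -/
def conj (t : T) {f : Idem T} (h : f.val = t⁻¹ * e.val * t) : Ker Q e →* Ker Q f where
  toFun k := ⟨t⁻¹ * k.val * t, by rw [h, map_mul, map_mul, k.ψ_val, ← map_mul, ← map_mul]⟩
  map_one' := Ker.ext h.symm
  map_mul' a b := Ker.ext (by
    change t⁻¹ * (a.val * b.val) * t = t⁻¹ * a.val * t * (t⁻¹ * b.val * t)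
    calc t⁻¹ * (a.val * b.val) * t = t⁻¹ * t * t⁻¹ * (a.val * b.val) * t := by rw [inv_mul_inv]
      _ = t⁻¹ * (t * t⁻¹ * a.val) * b.val * t := by simp only [mul_assoc]
      _ = _ := by rw [← Q.ker_comm a.ψ_val (mul_inv_idem t)]; simp only [mul_assoc])

theorem conj_conj (s t : T) {f g : Idem T} (h1 : f.val = s⁻¹ * e.val * s)
    (h2 : g.val = t⁻¹ * f.val * t) (h3 : g.val = (s * t)⁻¹ * e.val * (s * t)) (k : Ker Q e) :
    conj (s * t) h3 k = conj t h2 (conj s h1 k) :=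
  Ker.ext (by
    change (s * t)⁻¹ * k.val * (s * t) = t⁻¹ * (s⁻¹ * k.val * s) * t
    rw [mul_inv_rev']; simp only [mul_assoc])

/-- For elements `s`, `t` with the same image in `M`, the element `s⁻¹et` of `K_f`. -/
def diff (s t : T) {f : Idem T} (hs : f.val = s⁻¹ * e.val * s) (hst : Q.ψ s = Q.ψ t) : Ker Q f :=
  ⟨s⁻¹ * e.val * t, by rw [hs, map_mul, ← hst, ← map_mul]⟩

theorem conj_diff (s t : T) {f : Idem T} (hs : f.val = s⁻¹ * e.val * s)
    (ht : f.val = t⁻¹ * e.val * t) (hst : Q.ψ s = Q.ψ t) (k : Ker Q e) :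
    conj s hs k * diff s t hs hst = diff s t hs hst * conj t ht k :=
  Ker.ext (by
    change s⁻¹ * k.val * s * (s⁻¹ * e.val * t) = s⁻¹ * e.val * t * (t⁻¹ * k.val * t)
    calc s⁻¹ * k.val * s * (s⁻¹ * e.val * t) = s⁻¹ * (k.val * (s * s⁻¹)) * e.val * t := by
          simp only [mul_assoc]
      _ = s⁻¹ * s * s⁻¹ * (k.val * e.val) * t := by
          rw [Q.ker_comm k.ψ_val (mul_inv_idem s)]; simp only [mul_assoc]
      _ = s⁻¹ * k.val * t := by rw [inv_mul_inv, Q.mul_idem_of_ker k.ψ_val]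
      _ = s⁻¹ * (e.val * k.val) * (t * t⁻¹ * t) := by
          rw [mul_inv_mul, Q.idem_mul_of_ker k.ψ_val]
      _ = s⁻¹ * e.val * (k.val * (t * t⁻¹)) * t := by simp only [mul_assoc]
      _ = _ := by rw [Q.ker_comm k.ψ_val (mul_inv_idem t)]; simp only [mul_assoc])

end Ker

/-- The abelianised groups `K_e^ab`. -/
abbrev KerAb (e : Idem T) : Type u := Additive (Abelianization (Ker Q e))

/-- The action of `T` on the groups `K_e^ab` by conjugation. -/
def kerAction : GradedAction T Q.KerAb where
  act t {_ _} h := MonoidHom.toAdditive (Abelianization.map (Ker.conj t h))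
  act_mul s t {e f g} h1 h2 h3 a := by
    induction a using Additive.rec with | _ a
    induction a using QuotientGroup.induction_on with | _ k
    exact congrArg (fun k => Additive.ofMul (Abelianization.of k)) (Ker.conj_conj s t h1 h2 h3 k)
  act_self e h a := by
    induction a using Additive.rec with | _ a
    induction a using QuotientGroup.induction_on with | _ k
    refine congrArg (fun k => Additive.ofMul (Abelianization.of k)) (Ker.ext ?_)
    change e.val⁻¹ * k.val * e.val = k.val
    rw [idem_inv e.idem, Q.idem_mul_of_ker k.ψ_val, Q.mul_idem_of_ker k.ψ_val]

theorem of_eq_of_conj {G : Type u} [Group G] {a b u : G} (h : a * u = u * b) :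
    Abelianization.of a = Abelianization.of b := by
  have := congrArg Abelianization.of h
  rw [map_mul, map_mul, mul_comm] at this
  exact mul_left_cancel this

theorem kerAction_congr (s t : T) {e f : Idem T} (hs : f.val = s⁻¹ * e.val * s)
    (ht : f.val = t⁻¹ * e.val * t) (hst : Q.ψ s = Q.ψ t) (a : Q.KerAb e) :
    Q.kerAction.act s hs a = Q.kerAction.act t ht a := by
  induction a using Additive.rec with | _ a
  induction a using QuotientGroup.induction_on with | _ k
  exact congrArg Additive.ofMul (of_eq_of_conj (Ker.conj_diff s t hs ht hst k))

/-- The module `⊔ K_e^ab`, with the action `k ◁ m = t⁻¹kt` for any `t` over `m`. -/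
noncomputable def kerModule : LauschModule.{v, u} M :=
  (Q.descend Q.kerAction Q.kerAction_congr).toModule

end SepQuotient

/-! ### The Squier complex and its fundamental groupoid -/

namespace SepQuotient

variable {ι : Type w} {T : Type u} {M : Type v} [InverseMonoid T] [InverseMonoid M]
  (Q : SepQuotient ι T M)

/-- An edge `(p, l, r, q)` of the Squier complex, with an orientation: it leads from `plq` to `prq`
if `fwd` is true, and is the reverse of that edge otherwise. -/
@[ext] structure Edge (Q : SepQuotient ι T M) : Type (max u w) where
  p : T
  rel : ι
  q : T
  fwd : Bool

namespace Edge

variable {Q}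

/-- The initial vertex. -/
def src (s : Edge Q) : T := s.p * (bif s.fwd then Q.lhs s.rel else Q.rhs s.rel) * s.q

/-- The terminal vertex. -/
def tgt (s : Edge Q) : T := s.p * (bif s.fwd then Q.rhs s.rel else Q.lhs s.rel) * s.q

/-- The reverse edge. -/
def symm (s : Edge Q) : Edge Q := ⟨s.p, s.rel, s.q, !s.fwd⟩

/-- `x ▷ (p, l, r, q) = (xp, l, r, q)`. -/
def wL (x : T) (s : Edge Q) : Edge Q := ⟨x * s.p, s.rel, s.q, s.fwd⟩

/-- `(p, l, r, q) ◁ y = (p, l, r, qy)`. -/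
def wR (y : T) (s : Edge Q) : Edge Q := ⟨s.p, s.rel, s.q * y, s.fwd⟩

theorem src_symm (s : Edge Q) : s.symm.src = s.tgt := by
  rcases s with ⟨p, i, q, _ | _⟩ <;> rfl

theorem tgt_symm (s : Edge Q) : s.symm.tgt = s.src := by
  rcases s with ⟨p, i, q, _ | _⟩ <;> rfl

theorem symm_symm (s : Edge Q) : s.symm.symm = s := by
  rcases s with ⟨p, i, q, _ | _⟩ <;> rfl

theorem src_wL (x : T) (s : Edge Q) : (s.wL x).src = x * s.src := by
  simp only [wL, src, mul_assoc]

theorem tgt_wL (x : T) (s : Edge Q) : (s.wL x).tgt = x * s.tgt := by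
  simp only [wL, tgt, mul_assoc]

theorem src_wR (x : T) (s : Edge Q) : (s.wR x).src = s.src * x := by
  simp only [wR, src, mul_assoc]

theorem tgt_wR (x : T) (s : Edge Q) : (s.wR x).tgt = s.tgt * x := by
  simp only [wR, tgt, mul_assoc]

theorem ψ_src (s : Edge Q) : Q.ψ s.src = Q.ψ s.tgt := by
  have h : ∀ i, Q.ψ (Q.lhs i) = Q.ψ (Q.rhs i) := fun i => by
    have : Con.ker Q.ψ (Q.lhs i) (Q.rhs i) := by
      rw [Q.ker_eq]; exact ConGen.Rel.of _ _ ⟨i, rfl, rfl⟩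
    exact this
  rcases s with ⟨p, i, q, _ | _⟩ <;> simp [src, tgt, h]

end Edge

/-- `L` is an edge path from `a` to `b`. -/
def IsPath : T → List (Edge Q) → T → Prop
  | a, [], b => a = b
  | a, s :: L, b => s.src = a ∧ IsPath s.tgt L b

theorem isPath_append {Q : SepQuotient ι T M} {L L' : List (Edge Q)} {a b c : T} (h : Q.IsPath a L b)
    (h' : Q.IsPath b L' c) : Q.IsPath a (L ++ L') c := by
  induction L generalizing a with
  | nil => cases h; exact h'
  | cons s L ih => exact ⟨h.1, ih h.2⟩

/-- The elementary homotopies: deletion of an edge followed by its reverse, and replacement of one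
half of the boundary of a `2`-cell by the other half. -/
inductive Elementary : List (Edge Q) → List (Edge Q) → Prop
  | cancel (U V : List (Edge Q)) (s : Edge Q) : Elementary (U ++ s :: s.symm :: V) (U ++ V)
  | square (U V : List (Edge Q)) (p q p' q' : T) (i j : ι) :
      Elementary
        (U ++ ⟨p, i, q * p' * Q.lhs j * q', true⟩ :: ⟨p * Q.rhs i * q * p', j, q', true⟩ :: V)
        (U ++ ⟨p * Q.lhs i * q * p', j, q', true⟩ :: ⟨p, i, q * p' * Q.rhs j * q', true⟩ :: V)

/-- Edge paths in the Squier complex. -/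
@[ext] structure EdgePath : Type (max u w) where
  src : T
  tgt : T
  steps : List (Edge Q)
  isPath : Q.IsPath src steps tgt

namespace EdgePath

variable {Q}

/-- Elementary homotopy of edge paths with the same end points. -/
def Step (a b : EdgePath Q) : Prop :=
  a.src = b.src ∧ a.tgt = b.tgt ∧ Q.Elementary a.steps b.steps

/-- The constant path. -/
def const (x : T) : EdgePath Q := ⟨x, x, [], rfl⟩

/-- Concatenation of paths. -/
def comp (a b : EdgePath Q) (h : a.tgt = b.src) : EdgePath Q :=
  ⟨a.src, b.tgt, a.steps ++ b.steps, isPath_append a.isPath (h ▸ b.isPath)⟩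

/-- The path consisting of one edge. -/
def single (s : Edge Q) : EdgePath Q := ⟨s.src, s.tgt, [s], rfl, rfl⟩

theorem isPath_rev {L : List (Edge Q)} {a b : T} (h : Q.IsPath a L b) :
    Q.IsPath b (L.reverse.map Edge.symm) a := by
  induction L generalizing a with
  | nil => exact h.symm
  | cons s L ih =>
    rw [List.reverse_cons, List.map_append]
    exact isPath_append (ih h.2) ⟨s.src_symm, s.tgt_symm.trans h.1⟩

/-- The reverse path. -/
def rev (a : EdgePath Q) : EdgePath Q :=
  ⟨a.tgt, a.src, a.steps.reverse.map Edge.symm, isPath_rev a.isPath⟩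

/-- The left action of `T` on paths. -/
def wL (x : T) (a : EdgePath Q) : EdgePath Q where
  src := x * a.src
  tgt := x * a.tgt
  steps := a.steps.map (Edge.wL x)
  isPath := by
    rcases a with ⟨a, b, L, h⟩
    induction L generalizing a with
    | nil => exact congrArg (x * ·) h
    | cons s L ih =>
      refine ⟨(s.src_wL x).trans (congrArg (x * ·) h.1), ?_⟩
      rw [Edge.tgt_wL]
      exact ih _ h.2

/-- The right action of `T` on paths. -/
def wR (y : T) (a : EdgePath Q) : EdgePath Q where
  src := a.src * y
  tgt := a.tgt * y
  steps := a.steps.map (Edge.wR y)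
  isPath := by
    rcases a with ⟨a, b, L, h⟩
    induction L generalizing a with
    | nil => exact congrArg (· * y) h
    | cons s L ih =>
      refine ⟨(s.src_wR y).trans (congrArg (· * y) h.1), ?_⟩
      rw [Edge.tgt_wR]
      exact ih _ h.2

/-- `a ∗ b = (a ◁ d(b)) ∘ (r(a) ▷ b)`. -/
def ast (a b : EdgePath Q) : EdgePath Q := comp (wR b.src a) (wL a.tgt b) rfl

/-- `a ⊛ b = (d(a) ▷ b) ∘ (a ◁ r(b))`. -/
def ast' (a b : EdgePath Q) : EdgePath Q := comp (wL a.src b) (wR b.tgt a) rfl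

theorem wL_wL (x y : T) (a : EdgePath Q) : wL x (wL y a) = wL (x * y) a := by
  ext1
  · exact (mul_assoc _ _ _).symm
  · exact (mul_assoc _ _ _).symm
  · simp only [wL, List.map_map]
    congr 1; funext s; simp only [Function.comp, Edge.wL, mul_assoc]

theorem wR_wR (x y : T) (a : EdgePath Q) : wR x (wR y a) = wR (y * x) a := by
  ext1
  · exact mul_assoc _ _ _
  · exact mul_assoc _ _ _
  · simp only [wR, List.map_map]
    congr 1; funext s; simp only [Function.comp, Edge.wR, mul_assoc]

theorem wL_wR (x y : T) (a : EdgePath Q) : wL x (wR y a) = wR y (wL x a) := by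
  ext1
  · exact (mul_assoc _ _ _).symm
  · exact (mul_assoc _ _ _).symm
  · simp only [wR, wL, List.map_map]
    congr 1

theorem comp_eq {a a' b b' : EdgePath Q} (ha : a = a') (hb : b = b') (h : a.tgt = b.src)
    (h' : a'.tgt = b'.src) : comp a b h = comp a' b' h' := by
  subst ha hb; rfl

theorem comp_assoc (a b c : EdgePath Q) (h1 : a.tgt = b.src) (h2 : b.tgt = c.src) :
    comp (comp a b h1) c h2 = comp a (comp b c h2) h1 := by
  ext1
  · rfl
  · rfl
  · exact List.append_assoc _ _ _

theorem wL_comp (x : T) (a b : EdgePath Q) (h : a.tgt = b.src) :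
    wL x (comp a b h) = comp (wL x a) (wL x b) (congrArg (x * ·) h) := by
  ext1
  · rfl
  · rfl
  · exact List.map_append

theorem wR_comp (x : T) (a b : EdgePath Q) (h : a.tgt = b.src) :
    wR x (comp a b h) = comp (wR x a) (wR x b) (congrArg (· * x) h) := by
  ext1
  · rfl
  · rfl
  · exact List.map_append

theorem rev_rev (a : EdgePath Q) : a.rev.rev = a := by
  ext1
  · rfl
  · rfl
  · simp only [rev, ← List.map_reverse, List.reverse_reverse, List.map_map]
    conv_rhs => rw [← List.map_id a.steps]
    congr 1; funext s; exact s.symm_symm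

theorem rev_comp (a b : EdgePath Q) (h : a.tgt = b.src) :
    (comp a b h).rev = comp b.rev a.rev h.symm := by
  ext1
  · rfl
  · rfl
  · simp only [rev, comp, List.reverse_append, List.map_append]

theorem rev_wL (x : T) (a : EdgePath Q) : (wL x a).rev = wL x a.rev := by
  ext1
  · rfl
  · rfl
  · simp only [rev, wL, ← List.map_reverse, List.map_map]
    congr 1

theorem rev_wR (x : T) (a : EdgePath Q) : (wR x a).rev = wR x a.rev := by
  ext1
  · rfl
  · rfl
  · simp only [rev, wR, ← List.map_reverse, List.map_map]
    congr 1

theorem const_comp (a : EdgePath Q) (x : T) (h : x = a.src) : comp (const x) a h = a := by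
  subst h; rfl

theorem comp_const (a : EdgePath Q) (x : T) (h : a.tgt = x) : comp a (const x) h = a := by
  subst h
  ext1
  · rfl
  · rfl
  · exact List.append_nil _

theorem ast_assoc (a b c : EdgePath Q) : ast (ast a b) c = ast a (ast b c) := by
  refine (comp_eq (wR_comp c.src (wR b.src a) (wL a.tgt b) rfl) rfl rfl rfl).trans
    ((comp_assoc _ _ _ _ _).trans ?_)
  refine comp_eq (wR_wR _ _ _) ?_ _ _
  exact (comp_eq (wL_wR _ _ _).symm (wL_wL a.tgt b.tgt c).symm _ rfl).trans
    (wL_comp a.tgt (wR c.src b) (wL b.tgt c) rfl).symm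

theorem induct {P : EdgePath Q → Prop} (h0 : ∀ x, P (const x)) (h1 : ∀ s, P (single s))
    (h2 : ∀ a b h, P a → P b → P (comp a b h)) (a : EdgePath Q) : P a := by
  rcases a with ⟨x, y, L, h⟩
  induction L generalizing x with
  | nil => cases h; exact h0 _
  | cons s L ih =>
    obtain ⟨rfl, h'⟩ := h
    exact h2 (single s) ⟨_, _, L, h'⟩ rfl (h1 s) (ih _ h')

/-- Homotopy of edge paths. -/
def Htpy (a b : EdgePath Q) : Prop := Relation.EqvGen Step a b

theorem Htpy.refl (a : EdgePath Q) : Htpy a a := Relation.EqvGen.refl a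

theorem Htpy.symm {a b : EdgePath Q} (h : Htpy a b) : Htpy b a := Relation.EqvGen.symm _ _ h

theorem Htpy.trans {a b c : EdgePath Q} (h : Htpy a b) (h' : Htpy b c) : Htpy a c :=
  Relation.EqvGen.trans _ _ _ h h'

theorem Htpy.of_eq {a b : EdgePath Q} (h : a = b) : Htpy a b := h ▸ Htpy.refl a

theorem Htpy.src_eq {a b : EdgePath Q} (h : Htpy a b) : a.src = b.src := by
  induction h with
  | rel _ _ h => exact h.1
  | refl => rfl
  | symm _ _ _ ih => exact ih.symm
  | trans _ _ _ _ _ ih1 ih2 => exact ih1.trans ih2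

theorem Htpy.tgt_eq {a b : EdgePath Q} (h : Htpy a b) : a.tgt = b.tgt := by
  induction h with
  | rel _ _ h => exact h.2.1
  | refl => rfl
  | symm _ _ _ ih => exact ih.symm
  | trans _ _ _ _ _ ih1 ih2 => exact ih1.trans ih2

theorem elem_append_right {L L' : List (Edge Q)} (h : Q.Elementary L L') (N : List (Edge Q)) :
    Q.Elementary (L ++ N) (L' ++ N) := by
  cases h with
  | cancel U V s =>
    simpa only [List.append_assoc, List.cons_append] using Elementary.cancel U (V ++ N) s
  | square U V p q p' q' i j =>
    simpa only [List.append_assoc, List.cons_append] using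
      Elementary.square U (V ++ N) p q p' q' i j

theorem elem_append_left {L L' : List (Edge Q)} (h : Q.Elementary L L') (N : List (Edge Q)) :
    Q.Elementary (N ++ L) (N ++ L') := by
  cases h with
  | cancel U V s => simpa only [List.append_assoc] using Elementary.cancel (N ++ U) V s
  | square U V p q p' q' i j =>
    simpa only [List.append_assoc] using Elementary.square (N ++ U) V p q p' q' i j

theorem elem_wL {L L' : List (Edge Q)} (h : Q.Elementary L L') (x : T) :
    Q.Elementary (L.map (Edge.wL x)) (L'.map (Edge.wL x)) := by
  cases h with
  | cancel U V s =>
    rw [List.map_append, List.map_append]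
    exact Elementary.cancel _ _ (s.wL x)
  | square U V p q p' q' i j =>
    rw [List.map_append, List.map_append]
    have := Elementary.square (Q := Q) (U.map (Edge.wL x)) (V.map (Edge.wL x)) (x * p) q p' q' i j
    simpa only [List.map_cons, Edge.wL, mul_assoc] using this

theorem elem_wR {L L' : List (Edge Q)} (h : Q.Elementary L L') (x : T) :
    Q.Elementary (L.map (Edge.wR x)) (L'.map (Edge.wR x)) := by
  cases h with
  | cancel U V s =>
    rw [List.map_append, List.map_append]
    exact Elementary.cancel _ _ (s.wR x)
  | square U V p q p' q' i j =>
    rw [List.map_append, List.map_append]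
    have := Elementary.square (Q := Q) (U.map (Edge.wR x)) (V.map (Edge.wR x)) p q p' (q' * x) i j
    simpa only [List.map_cons, Edge.wR, mul_assoc] using this

theorem Step.wL {a b : EdgePath Q} (h : Step a b) (x : T) : Step (wL x a) (wL x b) :=
  ⟨congrArg (x * ·) h.1, congrArg (x * ·) h.2.1, elem_wL h.2.2 x⟩

theorem Step.wR {a b : EdgePath Q} (h : Step a b) (x : T) : Step (wR x a) (wR x b) :=
  ⟨congrArg (· * x) h.1, congrArg (· * x) h.2.1, elem_wR h.2.2 x⟩

theorem Step.ast_left {a a' : EdgePath Q} (h : Step a a') (b : EdgePath Q) :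
    Step (ast a b) (ast a' b) := by
  refine ⟨(h.wR b.src).1, congrArg (· * b.tgt) h.2.1, ?_⟩
  simp only [ast, comp, h.2.1]
  exact elem_append_right (elem_wR h.2.2 _) _

theorem Step.ast_right {b b' : EdgePath Q} (a : EdgePath Q) (h : Step b b') :
    Step (ast a b) (ast a b') := by
  refine ⟨congrArg (a.src * ·) h.1, (h.wL a.tgt).2.1, ?_⟩
  simp only [ast, comp, h.1]
  exact elem_append_left (elem_wL h.2.2 _) _

theorem Htpy.wL {a b : EdgePath Q} (h : Htpy a b) (x : T) : Htpy (wL x a) (wL x b) := by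
  induction h with
  | rel _ _ h => exact .rel _ _ (h.wL x)
  | refl => exact .refl _
  | symm _ _ _ ih => exact Htpy.symm ih
  | trans _ _ _ _ _ ih1 ih2 => exact Htpy.trans ih1 ih2

theorem Htpy.comp_left {a a' : EdgePath Q} (h : Htpy a a') (b : EdgePath Q) (k : a.tgt = b.src)
    (k' : a'.tgt = b.src) : Htpy (comp a b k) (comp a' b k') := by
  induction h with
  | rel _ _ h => exact .rel _ _ ⟨h.1, rfl, elem_append_right h.2.2 _⟩
  | refl => exact .refl _
  | symm _ _ _ ih => exact Htpy.symm (ih k' k)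
  | trans _ _ _ h1 _ ih1 ih2 => exact Htpy.trans (ih1 k ((Htpy.tgt_eq h1).symm.trans k)) (ih2 _ k')

theorem Htpy.comp_right (a : EdgePath Q) {b b' : EdgePath Q} (h : Htpy b b') (k : a.tgt = b.src)
    (k' : a.tgt = b'.src) : Htpy (comp a b k) (comp a b' k') := by
  induction h with
  | rel _ _ h => exact .rel _ _ ⟨rfl, h.2.1, elem_append_left h.2.2 _⟩
  | refl => exact .refl _
  | symm _ _ _ ih => exact Htpy.symm (ih k' k)
  | trans _ _ _ h1 _ ih1 ih2 => exact Htpy.trans (ih1 k (k.trans (Htpy.src_eq h1))) (ih2 _ k')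

theorem comp_rev_self (a : EdgePath Q) : Htpy (comp a a.rev rfl) (const a.src) := by
  induction a using induct with
  | h0 x => exact .refl _
  | h1 s =>
    exact .rel _ _ ⟨rfl, rfl, Elementary.cancel [] [] s⟩
  | h2 a b h iha ihb =>
    have e1 : comp (comp a b h) (comp a b h).rev rfl =
        comp a (comp (comp b b.rev rfl) a.rev h.symm) h := by
      refine EdgePath.ext rfl rfl ?_
      simp only [comp, rev, List.reverse_append, List.map_append, List.append_assoc]
    rw [e1]
    refine (Htpy.comp_right a ((ihb.comp_left a.rev h.symm h.symm).trans
      (.of_eq (const_comp _ _ h.symm))) h rfl).trans iha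

theorem rev_comp_self (a : EdgePath Q) : Htpy (comp a.rev a rfl) (const a.tgt) := by
  exact (Htpy.of_eq (comp_eq rfl (rev_rev a).symm rfl rfl)).trans (comp_rev_self a.rev)

theorem Htpy.rev {a b : EdgePath Q} (h : Htpy a b) : Htpy a.rev b.rev := by
  have hs := h.src_eq
  have ht := h.tgt_eq
  have s1 : Htpy a.rev (comp a.rev (comp b b.rev rfl) hs) := by
    refine (Htpy.of_eq (comp_const a.rev _ hs).symm).trans ?_
    exact Htpy.comp_right _ (comp_rev_self b).symm _ _
  have s2 : Htpy (comp a.rev (comp b b.rev rfl) hs) (comp a.rev (comp a b.rev ht) rfl) :=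
    Htpy.comp_right _ (h.symm.comp_left _ _ _) _ _
  have s3 : Htpy (comp a.rev (comp a b.rev ht) rfl) b.rev := by
    exact (Htpy.of_eq (comp_assoc a.rev a b.rev rfl ht).symm).trans
      (((rev_comp_self a).comp_left b.rev ht ht).trans (.of_eq (const_comp _ _ ht)))
  exact (s1.trans s2).trans s3

theorem Htpy.flip {A B A' B' : EdgePath Q} (h1 : A.tgt = B'.src) (h2 : B.tgt = A'.src)
    (h : Htpy (comp A B' h1) (comp B A' h2)) :
    Htpy (comp A.rev B h.src_eq) (comp B' A'.rev h.tgt_eq) := by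
  have hs : A.src = B.src := h.src_eq
  have ht : B'.tgt = A'.tgt := h.tgt_eq
  have s1 : Htpy (comp A.rev B hs) (comp A.rev (comp B (comp A' A'.rev rfl) h2) hs) := by
    refine Htpy.comp_right _ ?_ _ _
    exact (Htpy.of_eq (comp_const B _ h2).symm).trans
      (Htpy.comp_right _ (comp_rev_self A').symm _ _)
  have s2 : Htpy (comp A.rev (comp B (comp A' A'.rev rfl) h2) hs)
      (comp A.rev (comp A (comp B' A'.rev ht) h1) rfl) := by
    refine Htpy.comp_right _ ?_ _ _
    exact (Htpy.of_eq (comp_assoc B A' A'.rev h2 rfl).symm).trans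
      ((h.symm.comp_left A'.rev rfl ht).trans (.of_eq (comp_assoc A B' A'.rev h1 ht)))
  refine (s1.trans s2).trans ?_
  exact (Htpy.of_eq (comp_assoc A.rev A (comp B' A'.rev ht) rfl h1).symm).trans
    (((rev_comp_self A).comp_left (comp B' A'.rev ht) h1 h1).trans
      (.of_eq (const_comp (comp B' A'.rev ht) _ h1)))

/-- The operations `∗` and `⊛` coincide up to homotopy. -/
theorem interchange (a b : EdgePath Q) : Htpy (ast a b) (ast' a b) := by
  have base : ∀ p i q p' j q', Htpy (ast (single (Q := Q) ⟨p, i, q, true⟩) (single ⟨p', j, q', true⟩))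
      (ast' (single ⟨p, i, q, true⟩) (single ⟨p', j, q', true⟩)) := by
    intro p i q p' j q'
    refine .rel _ _ ⟨rfl, rfl, ?_⟩
    have := Elementary.square (Q := Q) [] [] p q p' q' i j
    simpa [ast, ast', comp, single, wL, wR, Edge.wL, Edge.wR, Edge.src, Edge.tgt, mul_assoc]
      using this
  have revL : ∀ a b : EdgePath Q, Htpy (ast a b) (ast' a b) →
      Htpy (ast a.rev b) (ast' a.rev b) := by
    intro a b h
    have h' := Htpy.flip _ _ h
    refine (Htpy.of_eq ?_).trans (h'.trans (.of_eq ?_))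
    · exact comp_eq (rev_wR b.src a).symm rfl _ _
    · exact comp_eq rfl (rev_wR b.tgt a) _ _
  have revR : ∀ a b : EdgePath Q, Htpy (ast a b) (ast' a b) →
      Htpy (ast a b.rev) (ast' a b.rev) := by
    intro a b h
    have h' := (Htpy.flip _ _ h.symm).symm
    refine (Htpy.of_eq ?_).trans (h'.trans (.of_eq ?_))
    · exact comp_eq rfl (rev_wL a.tgt b).symm _ _
    · exact comp_eq (rev_wL a.src b) rfl _ _
  have sing : ∀ s : Edge Q, ∃ t : Edge Q, t.fwd = true ∧
      (single s = single t ∨ single s = (single t).rev) := by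
    rintro ⟨p, i, q, _ | _⟩
    · exact ⟨⟨p, i, q, true⟩, rfl, Or.inr rfl⟩
    · exact ⟨⟨p, i, q, true⟩, rfl, Or.inl rfl⟩
  induction a using induct with
  | h0 x =>
    exact .of_eq ((const_comp (wL x b) _ rfl).trans (comp_const (wL x b) _ rfl).symm)
  | h2 a₁ a₂ h ih1 ih2 =>
    have s1 : ast (comp a₁ a₂ h) b =
        comp (wR b.src a₁) (ast a₂ b) (congrArg (· * b.src) h) := by
      refine EdgePath.ext rfl rfl ?_
      simp only [ast, comp, wR, List.map_append, List.append_assoc]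
    have s2 : comp (wR b.src a₁) (ast' a₂ b) (congrArg (· * b.src) h) =
        comp (ast a₁ b) (wR b.tgt a₂) (congrArg (· * b.tgt) h) := by
      refine EdgePath.ext rfl rfl ?_
      simp only [ast, ast', comp, h, List.append_assoc]
    have s3 : comp (ast' a₁ b) (wR b.tgt a₂) (congrArg (· * b.tgt) h) = ast' (comp a₁ a₂ h) b := by
      refine EdgePath.ext rfl rfl ?_
      simp only [ast', comp, wR, List.map_append, List.append_assoc]
    rw [s1, ← s3]
    exact ((Htpy.comp_right _ ih2 _ _).trans (.of_eq s2)).trans (ih1.comp_left _ _ _)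
  | h1 s =>
    induction b using induct with
    | h0 x =>
      exact .of_eq ((comp_const (wR x (single s)) _ rfl).trans
        (const_comp (wR x (single s)) _ rfl).symm)
    | h1 t =>
      obtain ⟨s', hs, h1⟩ := sing s
      obtain ⟨t', ht, h2⟩ := sing t
      rcases s' with ⟨p, i, q, fs⟩
      rcases t' with ⟨p', j, q', ft⟩
      dsimp only at hs ht
      subst hs ht
      have h0 := base p i q p' j q'
      rcases h1 with h1 | h1 <;> rcases h2 with h2 | h2 <;> rw [h1, h2]
      · exact h0
      · exact revR _ _ h0
      · exact revL _ _ h0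
      · exact revL _ _ (revR _ _ h0)
    | h2 b₁ b₂ h ih1 ih2 =>
      have s1 : ast (single s) (comp b₁ b₂ h) =
          comp (ast (single s) b₁) (wL s.tgt b₂) (congrArg (s.tgt * ·) h) := by
        refine EdgePath.ext rfl rfl ?_
        simp only [ast, comp, single, wL, List.map_append, List.append_assoc]
      have s2 : comp (ast' (single s) b₁) (wL s.tgt b₂) (congrArg (s.tgt * ·) h) =
          comp (wL s.src b₁) (ast (single s) b₂) (congrArg (s.src * ·) h) := by
        refine EdgePath.ext rfl rfl ?_
        simp only [ast, ast', comp, single, h, List.append_assoc]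
      have s3 : comp (wL s.src b₁) (ast' (single s) b₂) (congrArg (s.src * ·) h) =
          ast' (single s) (comp b₁ b₂ h) := by
        refine EdgePath.ext rfl rfl ?_
        simp only [ast', comp, single, wL, List.map_append, List.append_assoc]
      rw [s1, ← s3]
      exact ((ih1.comp_left _ _ _).trans (.of_eq s2)).trans (Htpy.comp_right _ ih2 _ _)

theorem ψ_src (a : EdgePath Q) : Q.ψ a.src = Q.ψ a.tgt := by
  induction a using induct with
  | h0 x => rfl
  | h1 s => exact s.ψ_src
  | h2 a b h iha ihb => exact iha.trans ((congrArg Q.ψ h).trans ihb)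

/-- Two elements of `T` with the same image in `M` are joined by a path. -/
theorem exists_path {x y : T} (h : Q.ψ x = Q.ψ y) : ∃ a : EdgePath Q, a.src = x ∧ a.tgt = y := by
  let c : Con T :=
    { r := fun x y => ∃ a : EdgePath Q, a.src = x ∧ a.tgt = y
      iseqv :=
        { refl := fun x => ⟨const x, rfl, rfl⟩
          symm := fun ⟨a, h1, h2⟩ => ⟨a.rev, h2, h1⟩
          trans := fun ⟨a, h1, h2⟩ ⟨b, k1, k2⟩ => ⟨comp a b (h2.trans k1.symm), h1, k2⟩ }
      mul' := fun ⟨a, h1, h2⟩ ⟨b, k1, k2⟩ => ⟨ast a b,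
        by rw [← h1, ← k1]; rfl, by rw [← h2, ← k2]; rfl⟩ }
  have hle : Con.ker Q.ψ ≤ c := by
    rw [Q.ker_eq, Con.conGen_le]
    rintro _ _ ⟨i, rfl, rfl⟩
    exact ⟨single ⟨1, i, 1, true⟩, by simp [single, Edge.src], by simp [single, Edge.tgt]⟩
  exact hle (show Con.ker Q.ψ x y from h)

end EdgePath

/-- The fundamental groupoid of the Squier complex: homotopy classes of edge paths. -/
def Arrow : Type (max u w) := Quot (EdgePath.Step (Q := Q))

namespace Arrow

variable {Q}

/-- The homotopy class of a path. -/
def mk (a : EdgePath Q) : Arrow Q := Quot.mk _ a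

theorem mk_eq {a b : EdgePath Q} (h : EdgePath.Htpy a b) : mk a = mk b := Quot.eqvGen_sound h

theorem mk_surjective (α : Arrow Q) : ∃ a, mk a = α := Quot.exists_rep α

/-- The domain map `d`. -/
def src : Arrow Q → T := Quot.lift EdgePath.src fun _ _ h => h.1

/-- The range map `r`. -/
def tgt : Arrow Q → T := Quot.lift EdgePath.tgt fun _ _ h => h.2.1

/-- The inverse in the fundamental groupoid. -/
def rev : Arrow Q → Arrow Q :=
  Quot.lift (fun a => mk a.rev) fun _ _ h => mk_eq (EdgePath.Htpy.rev (.rel _ _ h))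

/-- The left action `x ▷ α`. -/
def wL (x : T) : Arrow Q → Arrow Q := Quot.map (EdgePath.wL x) fun _ _ h => h.wL x

/-- The right action `α ◁ y`. -/
def wR (y : T) : Arrow Q → Arrow Q := Quot.map (EdgePath.wR y) fun _ _ h => h.wR y

/-- The operation `α ∗ β = (α ◁ d(β)) ∘ (r(α) ▷ β)`. -/
def ast : Arrow Q → Arrow Q → Arrow Q :=
  Quot.map₂ EdgePath.ast (fun a _ _ h => EdgePath.Step.ast_right a h)
    (fun _ _ b h => EdgePath.Step.ast_left h b)

end Arrow

/-- The set `star_e^⋈ = {e ▷ α ◁ e : d(α) = e}`. -/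
@[ext] structure Star (e : Idem T) : Type (max u w) where
  val : Arrow Q
  exists_eq : ∃ α : Arrow Q, α.src = e.val ∧ val = (α.wR e.val).wL e.val

namespace Star

variable {Q} {e : Idem T}

/-- Paths `a` with domain `e` and `e ▷ a = a = a ◁ e`. -/
structure Good (e : Idem T) (a : EdgePath Q) : Prop where
  src_eq : a.src = e.val
  wL_eq : a.wL e.val = a
  wR_eq : a.wR e.val = a

theorem Good.ψ_tgt {a : EdgePath Q} (h : Good e a) : Q.ψ a.tgt = Q.ψ e.val := by
  rw [← a.ψ_src, h.src_eq]

theorem exists_good (α : Star Q e) : ∃ a : EdgePath Q, Good e a ∧ Arrow.mk a = α.val := by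
  rcases α with ⟨val, α, hα, rfl⟩
  obtain ⟨a, rfl⟩ := Arrow.mk_surjective α
  refine ⟨(a.wR e.val).wL e.val, ⟨?_, ?_, ?_⟩, rfl⟩
  · change e.val * (a.src * e.val) = e.val
    rw [show a.src = e.val from hα, e.idem, e.idem]
  · rw [EdgePath.wL_wL, e.idem]
  · rw [← EdgePath.wL_wR, EdgePath.wR_wR, e.idem]

/-- The element of `star_e^⋈` represented by a path. -/
def ofGood (a : EdgePath Q) (h : Good e a) : Star Q e :=
  ⟨Arrow.mk a, Arrow.mk a, h.src_eq, by
    change Arrow.mk a = Arrow.mk ((a.wR e.val).wL e.val)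
    rw [h.wR_eq, h.wL_eq]⟩

theorem ofGood_surjective (α : Star Q e) : ∃ a, ∃ h : Good e a, α = ofGood a h := by
  obtain ⟨a, h, h'⟩ := α.exists_good
  exact ⟨a, h, Star.ext h'.symm⟩

theorem Good.ast {a b : EdgePath Q} (ha : Good e a) (hb : Good e b) : Good e (a.ast b) := by
  refine ⟨?_, ?_, ?_⟩
  · change a.src * b.src = _
    rw [ha.src_eq, hb.src_eq, e.idem]
  · refine (EdgePath.wL_comp _ _ _ _).trans (EdgePath.comp_eq ?_ ?_ _ _)
    · rw [EdgePath.wL_wR, ha.wL_eq]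
    · rw [EdgePath.wL_wL, Q.idem_mul_of_ker ha.ψ_tgt]
  · refine (EdgePath.wR_comp _ _ _ _).trans (EdgePath.comp_eq ?_ ?_ _ _)
    · rw [EdgePath.wR_wR, hb.src_eq, e.idem]
    · rw [← EdgePath.wL_wR, hb.wR_eq]

theorem good_const : Good e (EdgePath.const (Q := Q) e.val) := by
  refine ⟨rfl, ?_, ?_⟩
  · ext1
    · exact e.idem
    · exact e.idem
    · rfl
  · ext1
    · exact e.idem
    · exact e.idem
    · rfl

theorem ker_inv {x : T} (h : Q.ψ x = Q.ψ e.val) : Q.ψ x⁻¹ = Q.ψ e.val := by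
  rw [map_inv', h, ← map_inv', idem_inv e.idem]

theorem Good.inv {a : EdgePath Q} (ha : Good e a) :
    Good e ((a.rev.wR a.src⁻¹).wL a.tgt⁻¹) := by
  refine ⟨?_, ?_, ?_⟩
  · change a.tgt⁻¹ * (a.tgt * a.src⁻¹) = _
    rw [← mul_assoc, Q.inv_mul_of_ker ha.ψ_tgt, ha.src_eq, idem_inv e.idem, e.idem]
  · rw [EdgePath.wL_wL, Q.idem_mul_of_ker (ker_inv ha.ψ_tgt)]
  · rw [← EdgePath.wL_wR, EdgePath.wR_wR, ha.src_eq, idem_inv e.idem, e.idem]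

/-- The operation `∗` on `star_e^⋈`. -/
instance : Mul (Star Q e) :=
  ⟨fun α β => ⟨α.val.ast β.val, by
    obtain ⟨a, ha, rfl⟩ := α.ofGood_surjective
    obtain ⟨b, hb, rfl⟩ := β.ofGood_surjective
    exact (ofGood _ (ha.ast hb)).exists_eq⟩⟩

/-- The identity arrow at `e`. -/
instance : One (Star Q e) := ⟨ofGood (EdgePath.const e.val) good_const⟩

/-- The inverse `α^* = r(α)⁻¹ ▷ α° ◁ d(α)⁻¹`, where `α°` is the inverse in the groupoid. -/
instance : Inv (Star Q e) :=
  ⟨fun α => ⟨(α.val.rev.wR α.val.src⁻¹).wL α.val.tgt⁻¹, by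
    obtain ⟨a, ha, rfl⟩ := α.ofGood_surjective
    exact (ofGood _ ha.inv).exists_eq⟩⟩

theorem ofGood_mul {a b : EdgePath Q} (ha : Good e a) (hb : Good e b) :
    ofGood a ha * ofGood b hb = ofGood (a.ast b) (ha.ast hb) := rfl

theorem ofGood_eq {a b : EdgePath Q} (ha : Good e a) (hb : Good e b) (h : EdgePath.Htpy a b) :
    ofGood a ha = ofGood b hb := Star.ext (Arrow.mk_eq h)

instance : Group (Star Q e) :=
  Group.ofLeftAxioms
    (fun α β γ => by
      obtain ⟨a, ha, rfl⟩ := α.ofGood_surjective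
      obtain ⟨b, hb, rfl⟩ := β.ofGood_surjective
      obtain ⟨c, hc, rfl⟩ := γ.ofGood_surjective
      exact ofGood_eq ((ha.ast hb).ast hc) (ha.ast (hb.ast hc)) (.of_eq (a.ast_assoc b c)))
    (fun α => by
      obtain ⟨a, ha, rfl⟩ := α.ofGood_surjective
      refine ofGood_eq (good_const.ast ha) ha (.of_eq ?_)
      exact (EdgePath.const_comp (a.wL e.val) _ rfl).trans ha.wL_eq)
    (fun α => by
      obtain ⟨a, ha, rfl⟩ := α.ofGood_surjective
      refine ofGood_eq (ha.inv.ast ha) good_const ?_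
      have h1 : ((a.rev.wR a.src⁻¹).wL a.tgt⁻¹).ast a =
          (EdgePath.comp a.rev a rfl).wL a.tgt⁻¹ := by
        refine Eq.trans (EdgePath.comp_eq ?_ ?_ rfl rfl)
          (EdgePath.wL_comp a.tgt⁻¹ a.rev a rfl).symm
        · rw [← EdgePath.wL_wR, EdgePath.wR_wR, ha.src_eq, idem_inv e.idem, e.idem,
            ← EdgePath.rev_wR, ha.wR_eq]
        · change a.wL (a.tgt⁻¹ * (a.src * a.src⁻¹)) = _
          rw [ha.src_eq, idem_inv e.idem, e.idem, Q.mul_idem_of_ker (ker_inv ha.ψ_tgt)]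
      rw [h1]
      refine (a.rev_comp_self.wL _).trans (.of_eq ?_)
      have h2 := Q.inv_mul_of_ker ha.ψ_tgt
      ext1
      · exact h2
      · exact h2
      · rfl)

theorem Good.act {a : EdgePath Q} (ha : Good e a) (t : T) {f : Idem T}
    (h : f.val = t⁻¹ * e.val * t) : Good f ((a.wR t).wL t⁻¹) := by
  refine ⟨?_, ?_, ?_⟩
  · change t⁻¹ * (a.src * t) = _
    rw [h, ha.src_eq, mul_assoc]
  · conv_lhs => rw [← ha.wL_eq]
    conv_rhs => rw [← ha.wL_eq]
    rw [← EdgePath.wL_wR, EdgePath.wL_wL t⁻¹, EdgePath.wL_wL]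
    congr 1
    rw [h]
    calc t⁻¹ * e.val * t * (t⁻¹ * e.val) = t⁻¹ * (e.val * (t * t⁻¹)) * e.val := by
          simp only [mul_assoc]
      _ = t⁻¹ * t * t⁻¹ * (e.val * e.val) := by
          rw [idem_comm e.idem (mul_inv_idem t)]; simp only [mul_assoc]
      _ = _ := by rw [inv_mul_inv, e.idem]
  · conv_lhs => rw [← ha.wR_eq]
    conv_rhs => rw [← ha.wR_eq]
    rw [← EdgePath.wL_wR, EdgePath.wR_wR, EdgePath.wR_wR, EdgePath.wR_wR]
    congr 2
    rw [h]
    calc e.val * (t * (t⁻¹ * e.val * t)) = e.val * (t * t⁻¹ * e.val) * t := by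
          simp only [mul_assoc]
      _ = e.val * e.val * (t * t⁻¹ * t) := by
          rw [← idem_comm e.idem (mul_inv_idem t)]; simp only [mul_assoc]
      _ = _ := by rw [mul_inv_mul, e.idem]

/-- The map `α ↦ t⁻¹ ▷ α ◁ t`. -/
def act (t : T) {f : Idem T} (h : f.val = t⁻¹ * e.val * t) : Star Q e →* Star Q f where
  toFun α := ⟨(α.val.wR t).wL t⁻¹, by
    obtain ⟨a, ha, rfl⟩ := α.ofGood_surjective
    exact (ofGood _ (ha.act t h)).exists_eq⟩
  map_one' := by
    refine ofGood_eq (good_const.act t h) good_const (.of_eq ?_)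
    have h' : t⁻¹ * (e.val * t) = f.val := by rw [h, mul_assoc]
    ext1
    · exact h'
    · exact h'
    · rfl
  map_mul' α β := by
    obtain ⟨a, ha, rfl⟩ := α.ofGood_surjective
    obtain ⟨b, hb, rfl⟩ := β.ofGood_surjective
    refine ofGood_eq ((ha.ast hb).act t h) ((ha.act t h).ast (hb.act t h)) (.of_eq ?_)
    have h1 : t * (t⁻¹ * (e.val * t)) = e.val * t := by
      calc t * (t⁻¹ * (e.val * t)) = t * t⁻¹ * e.val * t := by simp only [mul_assoc]
        _ = e.val * (t * t⁻¹ * t) := by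
            rw [← idem_comm e.idem (mul_inv_idem t)]; simp only [mul_assoc]
        _ = _ := by rw [mul_inv_mul]
    have h2 : t⁻¹ * (a.tgt * t) * t⁻¹ = t⁻¹ * a.tgt := by
      calc t⁻¹ * (a.tgt * t) * t⁻¹ = t⁻¹ * (a.tgt * (t * t⁻¹)) := by simp only [mul_assoc]
        _ = t⁻¹ * t * t⁻¹ * a.tgt := by
            rw [Q.ker_comm ha.ψ_tgt (mul_inv_idem t)]; simp only [mul_assoc]
        _ = _ := by rw [inv_mul_inv]
    refine (congrArg (EdgePath.wL t⁻¹) (EdgePath.wR_comp t _ _ _)).trans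
      ((EdgePath.wL_comp t⁻¹ _ _ _).trans (EdgePath.comp_eq ?_ ?_ _ _))
    · change _ = ((a.wR t).wL t⁻¹).wR (t⁻¹ * (b.src * t))
      rw [← EdgePath.wL_wR, EdgePath.wR_wR, EdgePath.wR_wR, hb.src_eq, h1]
    · change _ = ((b.wR t).wL t⁻¹).wL (t⁻¹ * (a.tgt * t))
      rw [EdgePath.wL_wL, h2, ← EdgePath.wL_wR, EdgePath.wL_wL]

theorem act_mul (s t : T) {f g : Idem T} (h1 : f.val = s⁻¹ * e.val * s)
    (h2 : g.val = t⁻¹ * f.val * t) (h3 : g.val = (s * t)⁻¹ * e.val * (s * t)) (α : Star Q e) :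
    act (s * t) h3 α = act t h2 (act s h1 α) := by
  obtain ⟨a, ha, rfl⟩ := α.ofGood_surjective
  refine ofGood_eq (ha.act (s * t) h3) ((ha.act s h1).act t h2) (.of_eq ?_)
  rw [mul_inv_rev', ← EdgePath.wL_wR s⁻¹ t, EdgePath.wL_wL, EdgePath.wR_wR]

theorem act_self (h : e.val = e.val⁻¹ * e.val * e.val) (α : Star Q e) : act e.val h α = α := by
  obtain ⟨a, ha, rfl⟩ := α.ofGood_surjective
  refine ofGood_eq (ha.act e.val h) ha (.of_eq ?_)
  rw [idem_inv e.idem, ha.wR_eq, ha.wL_eq]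

theorem act_of_eq {s t : T} (hst : s = t) {f : Idem T} (hs : f.val = s⁻¹ * e.val * s)
    (ht : f.val = t⁻¹ * e.val * t) (α : Star Q e) : act s hs α = act t ht α := by
  subst hst; rfl

/-- The range map `star_e^⋈ → K_e`. -/
def range : Star Q e →* Ker Q e where
  toFun α := ⟨α.val.tgt, by
    obtain ⟨a, ha, rfl⟩ := α.ofGood_surjective
    exact ha.ψ_tgt⟩
  map_one' := rfl
  map_mul' α β := by
    obtain ⟨a, ha, rfl⟩ := α.ofGood_surjective
    obtain ⟨b, hb, rfl⟩ := β.ofGood_surjective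
    rfl

theorem range_surjective : Function.Surjective (range (Q := Q) (e := e)) := by
  intro k
  obtain ⟨a, h1, h2⟩ := EdgePath.exists_path (Q := Q) k.ψ_val.symm
  refine ⟨⟨((Arrow.mk a).wR e.val).wL e.val, Arrow.mk a, h1, rfl⟩, Ker.ext ?_⟩
  change e.val * (a.tgt * e.val) = k.val
  rw [h2, Q.mul_idem_of_ker k.ψ_val, Q.idem_mul_of_ker k.ψ_val]

theorem range_act (t : T) {f : Idem T} (h : f.val = t⁻¹ * e.val * t) (α : Star Q e) :
    range (act t h α) = Ker.conj t h (range α) := by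
  obtain ⟨a, ha, rfl⟩ := α.ofGood_surjective
  exact Ker.ext (mul_assoc _ _ _).symm

theorem conj_range (β : Star Q e) :
    e.val = (range β).val⁻¹ * e.val * (range β).val := by
  rw [mul_assoc, Q.idem_mul_of_ker (range β).ψ_val, Q.inv_mul_of_ker (range β).ψ_val]

/-- The crossed module identity `α ∗ β = β ∗ α^{r(β)}`. -/
theorem mul_eq_mul_act (α β : Star Q e) :
    α * β = β * act (range β).val (conj_range β) α := by
  have hc := conj_range β
  obtain ⟨a, ha, rfl⟩ := α.ofGood_surjective
  obtain ⟨b, hb, rfl⟩ := β.ofGood_surjective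
  refine ofGood_eq (ha.ast hb) (hb.ast (ha.act b.tgt hc)) ((EdgePath.interchange a b).trans
    (.of_eq ?_))
  refine EdgePath.comp_eq ?_ ?_ _ _
  · change _ = b.wR (b.tgt⁻¹ * (a.src * b.tgt))
    rw [ha.src_eq, hb.wL_eq, Q.idem_mul_of_ker hb.ψ_tgt, Q.inv_mul_of_ker hb.ψ_tgt, hb.wR_eq]
  · rw [EdgePath.wL_wL, Q.mul_inv_of_ker hb.ψ_tgt, EdgePath.wL_wR, ha.wL_eq]

theorem act_congr (s t : T) {f : Idem T} (hs : f.val = s⁻¹ * e.val * s)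
    (ht : f.val = t⁻¹ * e.val * t) (hst : Q.ψ s = Q.ψ t) (α : Star Q e) :
    ∃ β : Star Q f, act s hs α * β = β * act t ht α := by
  obtain ⟨β, hβ⟩ := range_surjective (Ker.diff (Q := Q) s t hs hst)
  refine ⟨β, (mul_eq_mul_act _ β).trans (congrArg (β * ·) ?_)⟩
  have hst' := Q.mul_inv_eq hst
  have hv : (range β).val = s⁻¹ * e.val * t := congrArg Ker.val hβ
  have hc : f.val = (s⁻¹ * e.val * t)⁻¹ * f.val * (s⁻¹ * e.val * t) := by
    rw [← hv]; exact conj_range β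
  rw [act_of_eq hv (conj_range β) hc]
  obtain ⟨a, ha, rfl⟩ := α.ofGood_surjective
  refine ofGood_eq ((ha.act s hs).act _ hc) (ha.act t ht) (.of_eq ?_)
  have h1 : s * (s⁻¹ * e.val * t) = e.val * t := by
    calc s * (s⁻¹ * e.val * t) = s * s⁻¹ * e.val * t := by simp only [mul_assoc]
      _ = e.val * (t * t⁻¹ * t) := by
          rw [← idem_comm e.idem (mul_inv_idem s), hst']; simp only [mul_assoc]
      _ = _ := by rw [mul_inv_mul]
  have h2 : (s⁻¹ * e.val * t)⁻¹ * s⁻¹ = t⁻¹ * e.val := by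
    rw [← mul_inv_rev', h1, mul_inv_rev', idem_inv e.idem]
  rw [← EdgePath.wL_wR, EdgePath.wL_wL, EdgePath.wR_wR, h1, h2]
  rw [← EdgePath.wR_wR, EdgePath.wL_wR, EdgePath.wL_wR, ← EdgePath.wL_wL]
  rw [ha.wL_eq, ← EdgePath.wL_wR t⁻¹ e.val, ha.wR_eq, ← EdgePath.wL_wR]

end Star

/-- The group `π_e^⋈` of the elements of `star_e^⋈` with range `e`. -/
def IdentityGroup (e : Idem T) : Subgroup (Star Q e) where
  carrier := {α | α.val.tgt = e.val}
  one_mem' := rfl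
  mul_mem' {α β} hα hβ := by
    have h := congrArg Ker.val (map_mul Star.range α β)
    change (α * β).val.tgt = α.val.tgt * β.val.tgt at h
    change (α * β).val.tgt = e.val
    rw [h, show α.val.tgt = e.val from hα, show β.val.tgt = e.val from hβ, e.idem]
  inv_mem' {α} hα := by
    have h := congrArg Ker.val (map_inv Star.range α)
    change α⁻¹.val.tgt = α.val.tgt⁻¹ at h
    change α⁻¹.val.tgt = e.val
    rw [h, show α.val.tgt = e.val from hα, idem_inv e.idem]

namespace IdentityGroup

variable {Q} {e : Idem T}

theorem central {α : Star Q e} (hα : α ∈ Q.IdentityGroup e) (β : Star Q e) : β * α = α * β := by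
  have hv : (Star.range α).val = e.val := hα
  have hc : e.val = e.val⁻¹ * e.val * e.val := by rw [idem_inv e.idem, e.idem, e.idem]
  rw [Star.mul_eq_mul_act β α, Star.act_of_eq hv _ hc, Star.act_self]

instance : CommGroup (Q.IdentityGroup e) :=
  { (inferInstance : Group (Q.IdentityGroup e)) with
    mul_comm := fun α β => Subtype.ext (central β.2 α.1) }

/-- The map `α ↦ t⁻¹ ▷ α ◁ t` on the groups `π_e^⋈`. -/
def act (t : T) {f : Idem T} (h : f.val = t⁻¹ * e.val * t) :
    Q.IdentityGroup e →* Q.IdentityGroup f :=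
  ((Star.act t h).comp (Q.IdentityGroup e).subtype).codRestrict (Q.IdentityGroup f) fun α => by
    have h1 := congrArg Ker.val (Star.range_act t h α.1)
    change (Star.act t h α.1).val.tgt = t⁻¹ * α.1.val.tgt * t at h1
    change (Star.act t h α.1).val.tgt = f.val
    rw [h1, show α.1.val.tgt = e.val from α.2, h]

end IdentityGroup

/-! ### The modules and the maps of the exact sequence -/

/-- The action of `T` on the groups `π_e^⋈`. -/
def identityAction : GradedAction T fun e => Additive (Q.IdentityGroup e) where
  act t {_ _} h := MonoidHom.toAdditive (IdentityGroup.act t h)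
  act_mul s t {e f g} h1 h2 h3 a := by
    induction a using Additive.rec with | _ a
    exact congrArg Additive.ofMul (Subtype.ext (Star.act_mul s t h1 h2 h3 a.1))
  act_self e h a := by
    induction a using Additive.rec with | _ a
    exact congrArg Additive.ofMul (Subtype.ext (Star.act_self h a.1))

theorem identityAction_congr (s t : T) {e f : Idem T} (hs : f.val = s⁻¹ * e.val * s)
    (ht : f.val = t⁻¹ * e.val * t) (hst : Q.ψ s = Q.ψ t) (a : Additive (Q.IdentityGroup e)) :
    Q.identityAction.act s hs a = Q.identityAction.act t ht a := by
  induction a using Additive.rec with | _ a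
  refine congrArg Additive.ofMul (Subtype.ext ?_)
  obtain ⟨β, hβ⟩ := Star.act_congr s t hs ht hst a.1
  change Star.act s hs a.1 = Star.act t ht a.1
  have h := IdentityGroup.central (IdentityGroup.act s hs a).2 β
  change β * Star.act s hs a.1 = Star.act s hs a.1 * β at h
  rw [← h] at hβ
  exact mul_left_cancel hβ

/-- The module `⊔ π_e^⋈`, with the action `α ◁ m = t⁻¹ ▷ α ◁ t` for any `t` over `m`. -/
noncomputable def identityModule : LauschModule.{v, max u w} M :=
  (Q.descend Q.identityAction Q.identityAction_congr).toModule

/-- The abelianised groups `(star_e^⋈)^ab`. -/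
abbrev StarAb (e : Idem T) : Type (max u w) := Additive (Abelianization (Star Q e))

/-- The action of `T` on the groups `(star_e^⋈)^ab`. -/
def starAction : GradedAction T Q.StarAb where
  act t {_ _} h := MonoidHom.toAdditive (Abelianization.map (Star.act t h))
  act_mul s t {e f g} h1 h2 h3 a := by
    induction a using Additive.rec with | _ a
    induction a using QuotientGroup.induction_on with | _ k
    exact congrArg (fun k => Additive.ofMul (Abelianization.of k)) (Star.act_mul s t h1 h2 h3 k)
  act_self e h a := by
    induction a using Additive.rec with | _ a
    induction a using QuotientGroup.induction_on with | _ k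
    exact congrArg (fun k => Additive.ofMul (Abelianization.of k)) (Star.act_self h k)

theorem starAction_congr (s t : T) {e f : Idem T} (hs : f.val = s⁻¹ * e.val * s)
    (ht : f.val = t⁻¹ * e.val * t) (hst : Q.ψ s = Q.ψ t) (a : Q.StarAb e) :
    Q.starAction.act s hs a = Q.starAction.act t ht a := by
  induction a using Additive.rec with | _ a
  induction a using QuotientGroup.induction_on with | _ k
  obtain ⟨β, hβ⟩ := Star.act_congr s t hs ht hst k
  exact congrArg Additive.ofMul (of_eq_of_conj hβ)

/-- The module `(S^⋈)^ab`, with the action induced by `α ↦ t⁻¹ ▷ α ◁ t` for any `t` over `m`. -/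
noncomputable def starModule : LauschModule.{v, max u w} M :=
  (Q.descend Q.starAction Q.starAction_congr).toModule

/-- A family of homomorphisms that commutes with the action of `T` gives a homomorphism of
`M`-modules. -/
noncomputable def descendHom {A : Idem T → Type w'} [∀ e, AddCommGroup (A e)]
    {B : Idem T → Type w''} [∀ e, AddCommGroup (B e)]
    (α : GradedAction T A) (hα) (β : GradedAction T B) (hβ) (φ : ∀ e, A e →+ B e)
    (hφ : ∀ (t : T) {e f : Idem T} (h : f.val = t⁻¹ * e.val * t) (a : A e),
      φ f (α.act t h a) = β.act t h (φ e a)) :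
    LauschModule.Hom (Q.descend α hα).toModule (Q.descend β hβ).toModule where
  app e := φ (Q.lift e)
  map_res _ a := hφ _ _ a
  map_act := by
    rintro ⟨e, a⟩ s
    exact congrArg (Sigma.mk (β := fun e => B (Q.lift e)) (e.conj s)) (hφ _ _ a)

/-- The map `⊔ π_e^⋈ → (S^⋈)^ab` induced by the inclusions `π_e^⋈ ⊆ star_e^⋈`. -/
noncomputable def inclusionHom : LauschModule.Hom Q.identityModule Q.starModule :=
  Q.descendHom Q.identityAction Q.identityAction_congr Q.starAction Q.starAction_congr
    (fun e => MonoidHom.toAdditive (Abelianization.of.comp (Q.IdentityGroup e).subtype))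
    (fun _ _ _ _ _ => rfl)

/-- The map `(S^⋈)^ab → ⊔ K_e^ab` induced by the range maps `star_e^⋈ → K_e`. -/
noncomputable def rangeHom : LauschModule.Hom Q.starModule Q.kerModule :=
  Q.descendHom Q.starAction Q.starAction_congr Q.kerAction Q.kerAction_congr
    (fun _ => MonoidHom.toAdditive (Abelianization.map Star.range))
    (fun t {e f} h a => by
      induction a using Additive.rec with | _ a
      induction a using QuotientGroup.induction_on with | _ k
      exact congrArg (fun k => Additive.ofMul (Abelianization.of k)) (Star.range_act t h k))

end SepQuotient

namespace InvPresentation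

variable {X : Type u} {M : Type v} [InverseMonoid M] (P : InvPresentation X M)

/-- The relation module `𝒦` of the presentation. -/
noncomputable def relationModule : LauschModule.{v, u} M := P.sep.kerModule

/-- The module of identities `⊔ π_e^⋈` of the presentation. -/
noncomputable def moduleOfIdentities : LauschModule.{v, u} M := P.sep.identityModule

/-- The abelianised crossed module `(S^⋈)^ab` of the presentation. -/
noncomputable def squierModule : LauschModule.{v, u} M := P.sep.starModule

/-- The map from the module of identities to `(S^⋈)^ab`. -/
noncomputable def inclusion : LauschModule.Hom P.moduleOfIdentities P.squierModule :=
  P.sep.inclusionHom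

/-- The map from `(S^⋈)^ab` to the relation module that is induced by the range map. -/
noncomputable def rangeMap : LauschModule.Hom P.squierModule P.relationModule := P.sep.rangeHom

end InvPresentation

end Modules

open InverseMonoid LauschModule

/-! ### Weights of edge paths -/

/-! Write an edge as `(p, l, r, q)`. For each idempotent `e` two facts are needed: `star_e` is a
split central extension of `K_e` by `π_e`, and its abelianisation is free abelian on the basis of a
free module, compatibly with the action.

Exactness. The crossed module identity makes the kernel `π_e` of the range map central, and the
range map is onto because elements of `𝒯` with the same image in `M` are joined by a path. Exactness
in the middle and on the right then holds for any surjection of groups (`Abelianization.map_exact`).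
Injectivity on the left is the real point: a section of the range map gives a retraction of `star_e`
onto a central subgroup that fixes `π_e`, and this factors through the abelianisation
(`eq_one_of_abelianization_eq_one`). The section exists because `K_e` is projective
(`exists_section`). Behind this is the Schützenberger graph of `e`, with vertices the `m` such that
`mm⁻¹ = e` and edges `m → mx` when `mxx⁻¹ = m`: an element of `K_e` acts as a loop at `e` in it, up
to backtracking. No basis of `K_e` is chosen. Instead each edge is labelled by a lift to `G` of
`t(m) x t(mx)⁻¹`, for a transversal `t`, and labels are multiplied along words. The product depends
only on the image of the word in `𝒯` (`cocycleCon_of_treeValue_eq`), and its image in `K_e`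
telescopes.

Freeness. Give the edge `(p, l, r, q)` the weight `(l = r, qψ)`, and its reverse the opposite
weight. The weight ignores `p`, and it is a homotopy invariant because `l` and `r` agree in `M`, so
it is a homomorphism from `star_e` to the free abelian group on the basis over `e`. Conversely, an
edge with `plq = e`, `ep = p` and `qe = q` must have `p = (lq)⁻¹`; such edges generate `star_e`
(`Star.closure_gens`), and modulo commutators they depend only on the image of `q` in `M`
(`Star.of_gen_congr`). Hence the weight induces an isomorphism (`starAbWeight_bijective`). -/

theorem List.map_eq_self_iff {A : Type u} {g : A → A} {L : List A} :
    L.map g = L ↔ ∀ a ∈ L, g a = a := by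
  rw [← List.map_inj_left (g := fun a => a), List.map_id']

/-! ### Factorisations of an idempotent in an inverse monoid -/

namespace InverseMonoid

variable {S : Type u} [InverseMonoid S]

/-- Uniqueness of inverses: the hypotheses say `aba = a` and `bab = b`. This is why the left
component of an edge at `e` is determined by the rest of the edge. -/
theorem eq_inv_of_mul_eq {e a b : S} (h : a * b = e) (ha : e * a = a) (hb : b * e = b) :
    a = b⁻¹ :=
  inv_unique b a (by rw [mul_assoc, h, hb]) (by rw [h, ha])

/-- Since `pl` is the inverse of `q`, the idempotent `qq⁻¹ = qpl` absorbs `l⁻¹l` on the right, so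
`qq⁻¹` lies below `l⁻¹l`. -/
theorem inv_mul_cancel_of_mul_eq {e p l q : S} (h : p * l * q = e) (hp : e * p = p)
    (hq : q * e = q) : l⁻¹ * (l * q) = q := by
  have hi : p * l = q⁻¹ := eq_inv_of_mul_eq h (by rw [← mul_assoc, hp]) hq
  have h1 : q * q⁻¹ * (l⁻¹ * l) = q * q⁻¹ := by
    rw [← hi]
    calc q * (p * l) * (l⁻¹ * l) = q * p * (l * l⁻¹ * l) := by simp only [mul_assoc]
      _ = _ := by rw [mul_inv_mul, mul_assoc]
  calc l⁻¹ * (l * q) = l⁻¹ * l * (q * q⁻¹) * q := by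
        conv_lhs => rw [← mul_inv_mul q]
        simp only [mul_assoc]
    _ = q := by rw [idem_comm (inv_mul_idem l) (mul_inv_idem q), h1, mul_inv_mul]

theorem inv_mul_self_of_mul_eq {e p l q : S} (h : p * l * q = e) (hp : e * p = p)
    (hq : q * e = q) : q⁻¹ * q = e := by
  rw [← eq_inv_of_mul_eq h (by rw [← mul_assoc, hp]) hq, h]

/-- Turns the order condition on a free basis element into an equation that can be used directly on
the components of an edge. -/
theorem dom_le_ran_iff {l q : S} : Idem.dom q ≤ Idem.ran l ↔ l⁻¹ * (l * q) = q := by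
  rw [Idem.le_def]
  simp only [Idem.dom, Idem.ran]
  constructor
  · intro h
    calc l⁻¹ * (l * q) = l⁻¹ * l * (q * q⁻¹) * q := by
          conv_lhs => rw [← mul_inv_mul q]
          simp only [mul_assoc]
      _ = q := by rw [← h, mul_inv_mul]
  · intro h
    rw [← mul_assoc, mul_assoc l⁻¹ l q, h]

end InverseMonoid

namespace SepQuotient

variable {ι : Type w} {T : Type u} {M : Type v} [InverseMonoid T] [InverseMonoid M]
  (Q : SepQuotient ι T M)

theorem ψ_lhs (i : ι) : Q.ψ (Q.lhs i) = Q.ψ (Q.rhs i) := by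
  have : Con.ker Q.ψ (Q.lhs i) (Q.rhs i) := by
    rw [Q.ker_eq]; exact ConGen.Rel.of _ _ ⟨i, rfl, rfl⟩
  exact this

/-- The family of sets that freely generates `(S^⋈)^ab`: the relation `l = r` lies over the
idempotent `l⁻¹l`. -/
def RelGen (f : Idem M) : Type w := {i : ι // Idem.ran (Q.ψ (Q.lhs i)) = f}

/-- The pair of a relation and an element of `M` is a basis element over `e`. -/
def IsBasic (e : Idem M) (i : ι) (m : M) : Prop :=
  Idem.dom m ≤ Idem.ran (Q.ψ (Q.lhs i)) ∧ Idem.ran m = e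

variable {Q} in
/-- The basis element given by a relation and an element of `M`. -/
def IsBasic.toBasis {e : Idem M} {i : ι} {m : M} (h : Q.IsBasic e i m) : FreeBasis Q.RelGen e :=
  ⟨⟨_, ⟨i, rfl⟩⟩, m, h.1, h.2⟩

open Classical in
/-- The basis element given by a relation and an element of `M`, or zero. -/
noncomputable def coeff (e : Idem M) (i : ι) (m : M) : FreeAbelianGroup (FreeBasis Q.RelGen e) :=
  if h : Q.IsBasic e i m then .of h.toBasis else 0

/-- The signed basis element given by an edge. -/
noncomputable def edgeWeight (e : Idem M) (s : Edge Q) : FreeAbelianGroup (FreeBasis Q.RelGen e) :=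
  bif s.fwd then Q.coeff e s.rel (Q.ψ s.q) else -Q.coeff e s.rel (Q.ψ s.q)

/-- The sum of the weights of the edges of a path. -/
noncomputable def weight (e : Idem M) (L : List (Edge Q)) :
    FreeAbelianGroup (FreeBasis Q.RelGen e) := (L.map (Q.edgeWeight e)).sum

variable {Q}

theorem weight_nil (e : Idem M) : Q.weight e [] = 0 := rfl

theorem weight_cons (e : Idem M) (s : Edge Q) (L : List (Edge Q)) :
    Q.weight e (s :: L) = Q.edgeWeight e s + Q.weight e L := by
  simp only [weight, List.map_cons, List.sum_cons]

theorem weight_append (e : Idem M) (L L' : List (Edge Q)) :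
    Q.weight e (L ++ L') = Q.weight e L + Q.weight e L' := by
  simp only [weight, List.map_append, List.sum_append]

theorem edgeWeight_symm (e : Idem M) (s : Edge Q) :
    Q.edgeWeight e s.symm = -Q.edgeWeight e s := by
  rcases s with ⟨p, i, q, _ | _⟩ <;> simp [edgeWeight, Edge.symm]

/-- The weight of an edge never reads its left component. -/
theorem weight_wL (e : Idem M) (x : T) (L : List (Edge Q)) :
    Q.weight e (L.map (Edge.wL x)) = Q.weight e L := by
  simp only [weight, List.map_map]
  rfl

/-- Around a square, opposite edges have right components that differ at most by `l'` in place of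
`r'`, which have the same image in `M`. The two halves of the boundary thus carry the same two
summands, in opposite orders. -/
theorem weight_elementary (e : Idem M) {L L' : List (Edge Q)} (h : Q.Elementary L L') :
    Q.weight e L = Q.weight e L' := by
  cases h with
  | cancel U V s =>
    simp only [weight_append, weight_cons, edgeWeight_symm, add_neg_cancel_left]
  | square U V p q p' q' i j =>
    simp only [weight_append, weight_cons, edgeWeight, cond_true, map_mul, Q.ψ_lhs]
    rw [add_left_comm (Q.coeff _ _ _)]

/-- The weight of an arrow of the fundamental groupoid. -/
noncomputable def Arrow.weight (e : Idem M) : Arrow Q → FreeAbelianGroup (FreeBasis Q.RelGen e) :=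
  Quot.lift (fun a => Q.weight e a.steps) fun _ _ h => weight_elementary e h.2.2

/-- The weight as a homomorphism on `star_e^⋈`. -/
noncomputable def Star.weight (f : Idem M) {e : Idem T} :
    Star Q e →* Multiplicative (FreeAbelianGroup (FreeBasis Q.RelGen f)) where
  toFun α := Multiplicative.ofAdd (α.val.weight f)
  map_one' := rfl
  map_mul' α β := by
    obtain ⟨a, ha, rfl⟩ := α.ofGood_surjective
    obtain ⟨b, hb, rfl⟩ := β.ofGood_surjective
    change Multiplicative.ofAdd (Q.weight f ((a.wR b.src).steps ++ (b.wL a.tgt).steps)) =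
      Multiplicative.ofAdd (Q.weight f a.steps + Q.weight f b.steps)
    -- The path `b` starts at `e`, which fixes `a` under right translation; the left translation of
    -- `b` does not affect weights.
    rw [hb.src_eq, ha.wR_eq, weight_append]
    exact congrArg (fun x => Multiplicative.ofAdd (_ + x)) (weight_wL f a.tgt b.steps)

theorem ψ_src_of_isPath {L : List (Edge Q)} {a b : T} (h : Q.IsPath a L b) {s : Edge Q}
    (hs : s ∈ L) : Q.ψ s.src = Q.ψ a := by
  induction L generalizing a with
  | nil => cases hs
  | cons t L ih =>
    rcases List.mem_cons.1 hs with rfl | hs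
    · rw [h.1]
    · rw [ih h.2 hs, ← t.ψ_src, h.1]

namespace Star

variable {e : Idem T}

/-- Invariance under `e` can be checked edge by edge; the terminal vertex needs no condition, since
it has the same image in `M` as `e` and is therefore fixed by `e` on both sides. -/
theorem Good.of_steps {a : EdgePath Q} (h : a.src = e.val)
    (hp : ∀ s ∈ a.steps, e.val * s.p = s.p) (hq : ∀ s ∈ a.steps, s.q * e.val = s.q) :
    Good e a := by
  have ht : Q.ψ a.tgt = Q.ψ e.val := by rw [← a.ψ_src, h]
  refine ⟨h, EdgePath.ext ?_ (Q.idem_mul_of_ker ht) ?_,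
    EdgePath.ext ?_ (Q.mul_idem_of_ker ht) ?_⟩
  · change e.val * a.src = a.src
    rw [h, e.idem]
  · exact List.map_eq_self_iff.2 fun s hs => Edge.ext (hp s hs) rfl rfl rfl
  · change a.src * e.val = a.src
    rw [h, e.idem]
  · exact List.map_eq_self_iff.2 fun s hs => Edge.ext rfl rfl (hq s hs) rfl

theorem Good.idem_mul_p {a : EdgePath Q} (ha : Good e a) {s : Edge Q} (hs : s ∈ a.steps) :
    e.val * s.p = s.p :=
  congrArg Edge.p (List.map_eq_self_iff.1 (congrArg EdgePath.steps ha.wL_eq) s hs)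

theorem Good.q_mul_idem {a : EdgePath Q} (ha : Good e a) {s : Edge Q} (hs : s ∈ a.steps) :
    s.q * e.val = s.q :=
  congrArg Edge.q (List.map_eq_self_iff.1 (congrArg EdgePath.steps ha.wR_eq) s hs)

/-- Every vertex of the path lies over `f`, so each edge gives a factorisation `plq` of `f` in `M`.
Consequently no edge of a good path falls under the default value zero of `coeff`. That default is
for other edges, which a homotopy may insert, such as edges with `qe ≠ q`. -/
theorem Good.isBasic {a : EdgePath Q} (ha : Good e a) {s : Edge Q} (hs : s ∈ a.steps)
    {f : Idem M} (hf : Q.ψ e.val = f.val) : Q.IsBasic f s.rel (Q.ψ s.q) := by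
  have h1 : f.val * Q.ψ s.p = Q.ψ s.p := by rw [← hf, ← map_mul, ha.idem_mul_p hs]
  have h2 : Q.ψ s.q * f.val = Q.ψ s.q := by rw [← hf, ← map_mul, ha.q_mul_idem hs]
  have h3 : Q.ψ s.p * Q.ψ (Q.lhs s.rel) * Q.ψ s.q = f.val := by
    rw [← hf, ← ha.src_eq, ← ψ_src_of_isPath a.isPath hs]
    rcases s with ⟨p, i, q, _ | _⟩ <;> simp [Edge.src, Q.ψ_lhs]
  exact ⟨dom_le_ran_iff.2 (inv_mul_cancel_of_mul_eq h3 h1 h2),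
    Idem.ext (inv_mul_self_of_mul_eq h3 h1 h2)⟩

end Star

/-- Basicness cannot be dropped: multiplying by `n` can make a pair basic that was not, for instance
when `n` is the idempotent `e` and `m⁻¹m` lies strictly above it. Then zero would have to go to a
basis element. -/
theorem coeff_act {e f : Idem M} {i : ι} {m n : M} (h : f.val = n⁻¹ * e.val * n)
    (hb : Q.IsBasic e i m) :
    (freeAction Q.RelGen).act n h (Q.coeff e i m) = Q.coeff f i (m * n) := by
  have hb' : Q.IsBasic f i (m * n) :=
    ⟨(hb.toBasis.act n h).dom_le, (hb.toBasis.act n h).ran_eq⟩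
  rw [coeff, dif_pos hb, coeff, dif_pos hb']
  exact FreeAbelianGroup.map_of_apply _

theorem weight_wR {e f : Idem M} {n : M} (h : f.val = n⁻¹ * e.val * n) {t : T} (ht : Q.ψ t = n)
    (L : List (Edge Q)) (hL : ∀ s ∈ L, Q.IsBasic e s.rel (Q.ψ s.q)) :
    Q.weight f (L.map (Edge.wR t)) = (freeAction Q.RelGen).act n h (Q.weight e L) := by
  induction L with
  | nil => exact (map_zero _).symm
  | cons s L ih =>
    rw [List.map_cons, weight_cons, weight_cons, map_add,
      ih fun s hs => hL s (List.mem_cons_of_mem _ hs)]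
    congr 1
    have hs := coeff_act h (hL s List.mem_cons_self)
    rcases s with ⟨p, i, q, _ | _⟩ <;>
      simp only [edgeWeight, Edge.wR, cond_true, cond_false, map_neg, map_mul, ht] at hs ⊢ <;>
      rw [hs]

/-- The left translation by `t⁻¹` is invisible to weights, and the right translation by `t` is the
free action because all edges of a good representative are basic. -/
theorem Star.weight_act {e f : Idem M} {n : M} (h : f.val = n⁻¹ * e.val * n) {t : T}
    (ht : Q.ψ t = n) {e' f' : Idem T} (he : Q.ψ e'.val = e.val) (h' : f'.val = t⁻¹ * e'.val * t)
    (α : Star Q e') :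
    (Star.weight f (Star.act t h' α)).toAdd =
      (freeAction Q.RelGen).act n h (Star.weight e α).toAdd := by
  obtain ⟨a, ha, rfl⟩ := α.ofGood_surjective
  exact (weight_wL f t⁻¹ (a.wR t).steps).trans
    (weight_wR h ht a.steps fun s hs => ha.isBasic hs he)

/-! ### Generators of the groups `star_e^⋈` -/

namespace Star

variable {e : Idem T}

/-- The edge starts at `q⁻¹l⁻¹lq = q⁻¹q = e`; the choice `p = (lq)⁻¹` is the only one possible. -/
theorem good_gen {i : ι} {q : T} (h1 : q⁻¹ * q = e.val) (h2 : (Q.lhs i)⁻¹ * (Q.lhs i * q) = q) :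
    Good e (EdgePath.single (Q := Q) ⟨(Q.lhs i * q)⁻¹, i, q, true⟩) := by
  have hq : q * e.val = q := by rw [← h1, ← mul_assoc, mul_inv_mul]
  have hp : e.val * (Q.lhs i * q)⁻¹ = (Q.lhs i * q)⁻¹ := by
    rw [← idem_inv e.idem, ← mul_inv_rev', mul_assoc, hq]
  refine Good.of_steps ?_ ?_ ?_
  · change (Q.lhs i * q)⁻¹ * Q.lhs i * q = e.val
    rw [mul_inv_rev', mul_assoc, mul_assoc, h2, h1]
  · intro s hs
    rw [List.mem_singleton.1 hs]; exact hp
  · intro s hs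
    rw [List.mem_singleton.1 hs]; exact hq

/-- The element of `star_e^⋈` given by the edge `(q⁻¹l⁻¹, l, r, q)`. -/
def gen (i : ι) (q : T) (h1 : q⁻¹ * q = e.val) (h2 : (Q.lhs i)⁻¹ * (Q.lhs i * q) = q) :
    Star Q e := ofGood _ (good_gen h1 h2)

theorem inv_mul_ran (l : T) :
    (l⁻¹ * l)⁻¹ * (l⁻¹ * l) = (Idem.ran l).val := by
  rw [idem_inv (inv_mul_idem _), inv_mul_idem]; rfl

theorem inv_mul_mul_ran (l : T) : l⁻¹ * (l * (l⁻¹ * l)) = l⁻¹ * l := by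
  rw [← mul_assoc l, mul_inv_mul]

/-- All generators belonging to one relation are translates of a single one, that with `q = l⁻¹l`.
This reduces comparison of generators to comparison of actions. -/
theorem gen_eq_act (i : ι) (q : T) (h1 : q⁻¹ * q = e.val)
    (h2 : (Q.lhs i)⁻¹ * (Q.lhs i * q) = q)
    (h3 : e.val = q⁻¹ * (Idem.ran (Q.lhs i)).val * q) :
    gen i q h1 h2 = act q h3 (gen i ((Q.lhs i)⁻¹ * Q.lhs i) (inv_mul_ran _)
      (inv_mul_mul_ran _)) := by
  have hl : ((Q.lhs i) * ((Q.lhs i)⁻¹ * Q.lhs i))⁻¹ = (Q.lhs i)⁻¹ := by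
    rw [← mul_assoc, mul_inv_mul]
  refine ofGood_eq (good_gen h1 h2)
    ((good_gen (inv_mul_ran _) (inv_mul_mul_ran _)).act q h3) (.of_eq ?_)
  have hs : (⟨(Q.lhs i * q)⁻¹, i, q, true⟩ : Edge Q) = Edge.wL q⁻¹ (Edge.wR q
      ⟨((Q.lhs i) * ((Q.lhs i)⁻¹ * Q.lhs i))⁻¹, i, (Q.lhs i)⁻¹ * Q.lhs i, true⟩) := by
    ext1
    · simp only [Edge.wL, Edge.wR, hl, mul_inv_rev']
    · rfl
    · simp only [Edge.wL, Edge.wR, mul_assoc, h2]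
    · rfl
  refine EdgePath.ext ?_ ?_ (congrArg (fun s => [s]) hs)
  · change Edge.src _ = _
    rw [hs, Edge.src_wL, Edge.src_wR]; rfl
  · change Edge.tgt _ = _
    rw [hs, Edge.tgt_wL, Edge.tgt_wR]; rfl

/-- Elements of `T` with the same image in `M` act on `star` in ways that differ by a conjugation
(`act_congr`), and this disappears in the abelianisation. The generators are translates of a common
element, by `gen_eq_act`. -/
theorem of_gen_congr (i : ι) {q q' : T} (h1 : q⁻¹ * q = e.val)
    (h2 : (Q.lhs i)⁻¹ * (Q.lhs i * q) = q) (h1' : q'⁻¹ * q' = e.val)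
    (h2' : (Q.lhs i)⁻¹ * (Q.lhs i * q') = q') (hq : Q.ψ q = Q.ψ q') :
    Abelianization.of (gen i q h1 h2) = Abelianization.of (gen i q' h1' h2') := by
  have h3 : ∀ q : T, q⁻¹ * q = e.val → (Q.lhs i)⁻¹ * (Q.lhs i * q) = q →
      e.val = q⁻¹ * (Idem.ran (Q.lhs i)).val * q := by
    intro q h1 h2
    rw [Idem.ran, mul_assoc, mul_assoc, h2, h1]
  rw [gen_eq_act i q h1 h2 (h3 q h1 h2), gen_eq_act i q' h1' h2' (h3 q' h1' h2')]
  obtain ⟨β, hβ⟩ := act_congr q q' (h3 q h1 h2) (h3 q' h1' h2') hq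
    (gen i ((Q.lhs i)⁻¹ * Q.lhs i) (inv_mul_ran _) (inv_mul_mul_ran _))
  exact of_eq_of_conj hβ

/-- An edge of a path that represents an element of `star_e^⋈` and starts at `e` is one of the
generators, if it is positively oriented. -/
theorem eq_gen {s : Edge Q} (hs : Good e (EdgePath.single s)) (hf : s.fwd = true) :
    ∃ h1 h2, ofGood _ hs = gen s.rel s.q h1 h2 := by
  rcases s with ⟨p, i, q, _ | _⟩
  · cases hf
  have hp : e.val * p = p := hs.idem_mul_p (s := ⟨p, i, q, true⟩) List.mem_cons_self
  have hq : q * e.val = q := hs.q_mul_idem (s := ⟨p, i, q, true⟩) List.mem_cons_self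
  have h : p * Q.lhs i * q = e.val := hs.src_eq
  have hpi : p = (Q.lhs i * q)⁻¹ :=
    eq_inv_of_mul_eq (by rw [← mul_assoc, h]) hp (by rw [mul_assoc, hq])
  subst hpi
  exact ⟨inv_mul_self_of_mul_eq h hp hq, inv_mul_cancel_of_mul_eq h hp hq, rfl⟩

/-- The generators of `star_e^⋈`. -/
def gens (e : Idem T) : Set (Star Q e) := {α | ∃ i q h1 h2, α = gen i q h1 h2}

theorem ofGood_single_mem {s : Edge Q} (hs : Good e (EdgePath.single s)) :
    ofGood _ hs ∈ Subgroup.closure (gens (Q := Q) e) := by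
  cases hf : s.fwd with
  | true =>
    obtain ⟨h1, h2, h⟩ := eq_gen hs hf
    exact Subgroup.subset_closure ⟨_, _, h1, h2, h⟩
  | false =>
    -- The `∗`-inverse of a negative edge is the reversed edge translated back to `e`. Only the left
    -- translation matters: right translation is by `e⁻¹ = e`, which fixes the edge.
    have hb : (EdgePath.single (s.symm.wL s.tgt⁻¹)) =
        ((EdgePath.single s).rev.wR (EdgePath.single s).src⁻¹).wL (EdgePath.single s).tgt⁻¹ := by
      have hq : s.q * s.src⁻¹ = s.q := by
        rw [show s.src = e.val from hs.src_eq, idem_inv e.idem]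
        exact hs.q_mul_idem List.mem_cons_self
      have h : s.symm.wL s.tgt⁻¹ = (s.symm.wR s.src⁻¹).wL s.tgt⁻¹ :=
        Edge.ext rfl rfl hq.symm rfl
      refine EdgePath.ext ?_ ?_ (congrArg (fun s => [s]) h)
      · change Edge.src _ = _
        rw [h, Edge.src_wL, Edge.src_wR, Edge.src_symm]; rfl
      · change Edge.tgt _ = _
        rw [h, Edge.tgt_wL, Edge.tgt_wR, Edge.tgt_symm]; rfl
    have hg : Good e (EdgePath.single (s.symm.wL s.tgt⁻¹)) := hb ▸ hs.inv
    obtain ⟨h1, h2, h⟩ := eq_gen hg (by simp [Edge.symm, Edge.wL, hf])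
    rw [← Subgroup.inv_mem_iff]
    refine Subgroup.subset_closure ⟨_, _, h1, h2, Eq.trans ?_ h⟩
    exact ofGood_eq hs.inv hg (.of_eq hb.symm)

/-- The group `star_e^⋈` is generated by the elements `(q⁻¹l⁻¹, l, r, q)`. -/
theorem closure_gens : Subgroup.closure (gens (Q := Q) e) = ⊤ := by
  rw [eq_top_iff]
  rintro α -
  obtain ⟨⟨x, y, L, hL⟩, ha, rfl⟩ := α.ofGood_surjective
  -- Induction on the length and not on the list, because the remaining edges are translated before
  -- the induction hypothesis is applied.
  induction hn : L.length generalizing x y L with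
  | zero =>
    obtain rfl := List.length_eq_zero_iff.1 hn
    obtain rfl : x = y := hL
    obtain rfl : x = e.val := ha.src_eq
    exact one_mem _
  | succ n ih =>
    rcases L with _ | ⟨s, L⟩
    · cases hn
    have hs : s.src = e.val := hL.1.trans ha.src_eq
    have hg : Good e (EdgePath.single s) := by
      refine Good.of_steps hs ?_ ?_
      · intro t ht
        rw [List.mem_singleton.1 ht]; exact ha.idem_mul_p List.mem_cons_self
      · intro t ht
        rw [List.mem_singleton.1 ht]; exact ha.q_mul_idem List.mem_cons_self
    have hk : Q.ψ s.tgt = Q.ψ e.val := hg.ψ_tgt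
    -- The tail starts at the end of the first edge, an element of `K_e`; translation by its inverse
    -- moves the start to `e`. In the product `single s ∗ b` the factor `b` is translated back,
    -- which recovers the path.
    let b : EdgePath Q := EdgePath.wL s.tgt⁻¹ ⟨s.tgt, y, L, hL.2⟩
    have hb : Good e b := by
      refine Good.of_steps (Q.inv_mul_of_ker hk) ?_ ?_
      · intro t ht
        obtain ⟨t, ht, rfl⟩ := List.mem_map.1 ht
        change e.val * (s.tgt⁻¹ * t.p) = s.tgt⁻¹ * t.p
        rw [← mul_assoc, Q.idem_mul_of_ker (ker_inv hk)]
      · intro t' ht'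
        obtain ⟨t, ht, rfl⟩ := List.mem_map.1 ht'
        exact ha.q_mul_idem (s := t) (List.mem_cons_of_mem s ht)
    have hab : (⟨x, y, s :: L, hL⟩ : EdgePath Q) = (EdgePath.single s).ast b := by
      have h1 : (EdgePath.single s).wR b.src = EdgePath.single s := by
        rw [hb.src_eq, hg.wR_eq]
      have h2 : b.wL s.tgt = ⟨s.tgt, y, L, hL.2⟩ := by
        rw [EdgePath.wL_wL, Q.mul_inv_of_ker hk]
        refine EdgePath.ext (Q.idem_mul_of_ker hk) (Q.idem_mul_of_ker ha.ψ_tgt) ?_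
        refine List.map_eq_self_iff.2 fun t ht => Edge.ext ?_ rfl rfl rfl
        exact ha.idem_mul_p (List.mem_cons_of_mem s ht)
      refine Eq.trans ?_ (EdgePath.comp_eq h1 h2 rfl rfl).symm
      exact EdgePath.ext hL.1.symm rfl rfl
    have hm : ofGood _ ha = ofGood _ hg * ofGood b hb :=
      ofGood_eq ha (hg.ast hb) (.of_eq hab)
    rw [hm]
    exact mul_mem (ofGood_single_mem hg) (ih _ _ _ _ hb (by simpa using hn))

end Star

/-! ### The inverse of the weight map, and freeness -/

theorem IsBasic.inv_mul_pick {e : Idem M} {m : M} (h : Idem.ran m = e) :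
    (Q.pick m)⁻¹ * Q.pick m = (Q.lift e).val := by
  refine Q.idem_eq (inv_mul_idem _) (Q.lift e).idem ?_
  rw [map_mul, map_inv', Q.ψ_pick, Q.ψ_lift, ← h]
  rfl

/-- The order condition compares idempotents, and `ψ` separates idempotents, so the condition on `m`
in `M` passes to a chosen element of `T` over `m`. -/
theorem IsBasic.lhs_mul_pick {i : ι} {m : M} (h : Idem.dom m ≤ Idem.ran (Q.ψ (Q.lhs i))) :
    (Q.lhs i)⁻¹ * (Q.lhs i * Q.pick m) = Q.pick m := by
  refine dom_le_ran_iff.1 (Idem.le_def.2 ?_)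
  refine Q.idem_eq (Idem.dom _).idem (idem_mul (Idem.ran _).idem (Idem.dom _).idem) ?_
  simpa only [Idem.dom, Idem.ran, map_mul, map_inv', Q.ψ_pick] using Idem.le_def.1 h

variable (Q) in
/-- The map from the free module that sends a basis element to the class of a generator. -/
noncomputable def ofBasis (e : Idem M) :
    FreeAbelianGroup (FreeBasis Q.RelGen e) →+ Q.StarAb (Q.lift e) :=
  FreeAbelianGroup.lift fun x => Additive.ofMul (Abelianization.of
    (Star.gen x.gen.2.1 (Q.pick x.elt) (IsBasic.inv_mul_pick x.ran_eq)
      (IsBasic.lhs_mul_pick (x.gen.2.2.symm ▸ x.dom_le))))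

theorem weight_gen (e : Idem M) (i : ι) (q : T) (h1 : q⁻¹ * q = (Q.lift e).val)
    (h2 : (Q.lhs i)⁻¹ * (Q.lhs i * q) = q) :
    ∃ hb : Q.IsBasic e i (Q.ψ q), (Star.weight e (Star.gen i q h1 h2)).toAdd = .of hb.toBasis := by
  have hb : Q.IsBasic e i (Q.ψ q) :=
    (Star.good_gen h1 h2).isBasic (s := ⟨_, i, q, true⟩) List.mem_cons_self (Q.ψ_lift e)
  refine ⟨hb, ?_⟩
  change Q.weight e [⟨_, i, q, true⟩] = _
  rw [weight_cons, weight_nil, add_zero]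
  exact dif_pos hb

/-- Both sides are homomorphisms in `α`, so generators suffice. There the chosen element over `qψ`
may differ from `q`, but `Star.of_gen_congr` makes this harmless in the abelianisation. -/
theorem ofBasis_weight (e : Idem M) (α : Star Q (Q.lift e)) :
    Q.ofBasis e (Star.weight e α).toAdd = Additive.ofMul (Abelianization.of α) := by
  have h : (AddMonoidHom.toMultiplicativeLeft (Q.ofBasis e)).comp (Star.weight e) =
      Abelianization.of := by
    refine MonoidHom.eq_of_eqOn_dense Star.closure_gens ?_
    rintro _ ⟨i, q, h1, h2, rfl⟩
    obtain ⟨hb, hw⟩ := weight_gen e i q h1 h2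
    change (Q.ofBasis e (Star.weight e (Star.gen i q h1 h2)).toAdd).toMul = _
    rw [hw, ofBasis, FreeAbelianGroup.lift_apply_of]
    exact Star.of_gen_congr i _ _ h1 h2 (Q.ψ_pick _)
  exact congrArg Additive.ofMul (DFunLike.congr_fun h α)

/-- The homomorphism `(star_e^⋈)^ab → F_e` given by the weights. -/
noncomputable def starAbWeight (e : Idem M) :
    Q.StarAb (Q.lift e) →+ FreeAbelianGroup (FreeBasis Q.RelGen e) :=
  MonoidHom.toAdditiveLeft (Abelianization.lift (Star.weight e))

theorem starAbWeight_bijective (e : Idem M) : Function.Bijective (starAbWeight (Q := Q) e) := by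
  have left : ∀ a, Q.ofBasis e (starAbWeight e a) = a := by
    intro a
    induction a using Additive.rec with | _ a
    induction a using QuotientGroup.induction_on with | _ k
    exact ofBasis_weight e k
  have right : ∀ a, starAbWeight e (Q.ofBasis e a) = a := by
    have h : (starAbWeight e).comp (Q.ofBasis e) = AddMonoidHom.id _ := by
      refine FreeAbelianGroup.lift_ext _ _ fun x => ?_
      rw [AddMonoidHom.comp_apply, ofBasis, FreeAbelianGroup.lift_apply_of]
      -- Eliminating `f` identifies the index of the generator with `l⁻¹l`, so that the two basis
      -- elements to be compared differ only in their components in `M`.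
      obtain ⟨⟨f, i, rfl⟩, m, h1, h2⟩ := x
      obtain ⟨hb, hw⟩ := weight_gen e i (Q.pick m) (IsBasic.inv_mul_pick h2)
        (IsBasic.lhs_mul_pick h1)
      refine hw.trans (congrArg FreeAbelianGroup.of (FreeBasis.ext rfl ?_))
      exact Q.ψ_pick m
    exact DFunLike.congr_fun h
  exact ⟨Function.LeftInverse.injective left, Function.RightInverse.surjective right⟩

theorem starModule_isFree : LauschModule.IsFree.{v, w, max u w} Q.starModule := by
  have key : ∀ {e f : Idem M} {n : M} (h : f.val = n⁻¹ * e.val * n)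
      (h' : (Q.lift f).val = (Q.pick n)⁻¹ * (Q.lift e).val * Q.pick n) (a : Q.StarAb (Q.lift e)),
      starAbWeight f (Q.starAction.act (Q.pick n) h' a) =
        (freeAction Q.RelGen).act n h (starAbWeight e a) := by
    intro e f n h h' a
    induction a using Additive.rec with | _ a
    induction a using QuotientGroup.induction_on with | _ k
    exact Star.weight_act h (Q.ψ_pick n) (Q.ψ_lift e) h' k
  refine ⟨Q.RelGen, ⟨starAbWeight, ?_, ?_⟩, starAbWeight_bijective⟩
  -- In both modules the structure maps are actions of idempotents, so equivariance covers them as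
  -- well.
  · intro e f h a
    exact key _ _ a
  · rintro ⟨e, a⟩ s
    exact congrArg (Sigma.mk (β := fun e => FreeAbelianGroup (FreeBasis Q.RelGen e)) (e.conj s))
      (key _ _ a)

end SepQuotient

/-! ### Splitting of central extensions -/

/-- The map `g ↦ g σ(f g)⁻¹` takes values in the kernel of `f`, which is central, and centrality
makes it a homomorphism. Its target is abelian, so it factors through the abelianisation; on the
kernel of `f` it is the identity. -/
theorem eq_one_of_abelianization_eq_one {G : Type u} {K : Type v} [Group G] [Group K] {f : G →* K}
    {σ : K →* G} (hσ : ∀ k, f (σ k) = k) (hf : ∀ a, f a = 1 → ∀ b, b * a = a * b) {a : G}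
    (ha : f a = 1) (h : Abelianization.of a = 1) : a = 1 := by
  have hz : ∀ g, g * (σ (f g))⁻¹ ∈ Subgroup.center G := fun g =>
    Subgroup.mem_center_iff.2 (hf _ (by rw [map_mul, map_inv, hσ, mul_inv_cancel]))
  let r : G →* Subgroup.center G :=
    { toFun := fun g => ⟨g * (σ (f g))⁻¹, hz g⟩
      map_one' := Subtype.ext (by simp)
      map_mul' := fun g g' => Subtype.ext (by
        change g * g' * (σ (f (g * g')))⁻¹ = g * (σ (f g))⁻¹ * (g' * (σ (f g'))⁻¹)
        have := Subgroup.mem_center_iff.1 (hz g') (σ (f g))⁻¹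
        rw [mul_assoc g (σ (f g))⁻¹, this, map_mul, map_mul, mul_inv_rev]
        simp only [mul_assoc]) }
  let _ : CommGroup (Subgroup.center G) :=
    { (inferInstance : Group (Subgroup.center G)) with
      mul_comm := fun x y => Subtype.ext (Subgroup.mem_center_iff.1 y.2 x.1) }
  have h1 : r a = 1 := by
    have hr := Abelianization.lift_apply_of (A := Subgroup.center G) r a
    rw [h, map_one] at hr
    exact hr.symm
  have h2 : a * (σ (f a))⁻¹ = 1 := congrArg Subtype.val h1
  rwa [ha, map_one, inv_one, mul_one] at h2

/-- A surjection maps the commutator subgroup onto the commutator subgroup, so `a` can be corrected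
by a product of commutators, without changing its class, to lie in the kernel of `f`. -/
theorem Abelianization.map_exact {G : Type u} {K : Type v} [Group G] [Group K] {f : G →* K}
    (hf : Function.Surjective f) {a : G} (h : Abelianization.of (f a) = 1) :
    ∃ b, f b = 1 ∧ Abelianization.of b = Abelianization.of a := by
  have h1 : f a ∈ commutator K := by
    rwa [← Abelianization.ker_of, MonoidHom.mem_ker]
  have h2 : (commutator G).map f = commutator K := by
    rw [commutator_def, commutator_def, Subgroup.map_commutator, ← MonoidHom.range_eq_map,
      MonoidHom.range_eq_top.2 hf]
  rw [← h2] at h1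
  obtain ⟨c, hc, hca⟩ := h1
  refine ⟨c⁻¹ * a, by rw [map_mul, map_inv, hca, inv_mul_cancel], ?_⟩
  have hc' : Abelianization.of c = 1 := by
    rw [← MonoidHom.mem_ker, Abelianization.ker_of]; exact hc
  rw [map_mul, map_inv, hc', inv_one, one_mul]

/-! ### Exactness from a section of the range map -/

namespace SepQuotient

variable {ι : Type w} {T : Type u} {M : Type v} [InverseMonoid T] [InverseMonoid M]
  (Q : SepQuotient ι T M)

/-- Only injectivity uses the section. The remaining parts follow from surjectivity of the range map
on `star_e`. -/
theorem shortExact_of_section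
    (H : ∀ e : Idem T, ∃ σ : Ker Q e →* Star Q e, ∀ k, Star.range (σ k) = k) :
    LauschModule.ShortExact Q.inclusionHom Q.rangeHom where
  injective e := by
    obtain ⟨σ, hσ⟩ := H (Q.lift e)
    refine (injective_iff_map_eq_zero _).2 fun a ha => ?_
    induction a using Additive.rec with | _ a
    have h1 : Star.range a.1 = 1 := Ker.ext a.2
    refine congrArg Additive.ofMul (Subtype.ext ?_)
    exact eq_one_of_abelianization_eq_one hσ
      (fun a ha b => IdentityGroup.central (congrArg Ker.val ha) b) h1 (congrArg Additive.toMul ha)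
  exact e a := by
    constructor
    · intro ha
      induction a using Additive.rec with | _ a
      induction a using QuotientGroup.induction_on with | _ k
      obtain ⟨b, hb, hbk⟩ := Abelianization.map_exact (f := Star.range) Star.range_surjective
        (a := k) (congrArg Additive.toMul ha)
      exact ⟨Additive.ofMul ⟨b, congrArg Ker.val hb⟩, congrArg Additive.ofMul hbk⟩
    · rintro ⟨b, rfl⟩
      induction b using Additive.rec with | _ b
      refine congrArg Additive.ofMul (?_ : Abelianization.of (Star.range b.1) = 1)
      rw [show Star.range b.1 = 1 from Ker.ext b.2, map_one]
  surjective e a := by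
    induction a using Additive.rec with | _ a
    induction a using QuotientGroup.induction_on with | _ k
    obtain ⟨α, rfl⟩ := Star.range_surjective k
    exact ⟨Additive.ofMul (Abelianization.of α), rfl⟩

end SepQuotient

/-! ### Domains of right multiplications -/

namespace InverseMonoid

variable {S : Type u} [InverseMonoid S]

/-- If `m` lies in the domain of right multiplication by `ab`, it lies in that of `a`. -/
theorem mul_mul_inv_left {m a b : S} (h : m * (a * b) * (a * b)⁻¹ = m) : m * a * a⁻¹ = m := by
  rw [mul_inv_rev'] at h
  have h' : m * (a * (b * b⁻¹) * a⁻¹) = m := by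
    simpa only [mul_assoc] using h
  calc m * a * a⁻¹ = m * (a * (b * b⁻¹) * (a⁻¹ * a * a⁻¹)) := by
        conv_lhs => rw [← h']
        simp only [mul_assoc]
    _ = m := by rw [inv_mul_inv, h']

/-- If `ab` can be read from `m`, then `b` can be read from `ma`. The commuting of `a⁻¹a` with
`bb⁻¹` is what moves `a` past `bb⁻¹`. -/
theorem mul_mul_inv_right {m a b : S} (h : m * (a * b) * (a * b)⁻¹ = m) :
    m * a * b * b⁻¹ = m * a := by
  rw [mul_inv_rev'] at h
  calc m * a * b * b⁻¹ = m * (a * a⁻¹ * a) * (b * b⁻¹) := by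
        rw [mul_inv_mul]; simp only [mul_assoc]
    _ = m * a * (a⁻¹ * a * (b * b⁻¹)) := by simp only [mul_assoc]
    _ = m * (a * b) * (b⁻¹ * a⁻¹) * a := by
        rw [idem_comm (inv_mul_idem a) (mul_inv_idem b)]; simp only [mul_assoc]
    _ = m * a := by rw [h]

end InverseMonoid

/-! ### Projectivity of the groups `K_e` -/

namespace InvPresentation

variable {X : Type u} {M : Type v} [InverseMonoid M] (P : InvPresentation X M)

/-- The image in `M` of a word. -/
def value : FreeMonoid (X × Bool) →* M := P.θ.comp FIM.ofWord

theorem value_inv (w : FreeMonoid (X × Bool)) : P.value (invWord w) = (P.value w)⁻¹ := by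
  change P.θ (FIM.ofWord (invWord w)) = (P.θ (FIM.ofWord w))⁻¹
  rw [← FIM.ofWord_inv, map_inv']

/-- The image in `𝒯(M, X)` of a word. -/
def treeValue : FreeMonoid (X × Bool) →* P.T := P.τ.comp FIM.ofWord

theorem treeValue_inv (w : FreeMonoid (X × Bool)) :
    P.treeValue (invWord w) = (P.treeValue w)⁻¹ := by
  change P.τ (FIM.ofWord (invWord w)) = (P.τ (FIM.ofWord w))⁻¹
  rw [← FIM.ofWord_inv, map_inv']

theorem ψ_treeValue (w : FreeMonoid (X × Bool)) : P.sep.ψ (P.treeValue w) = P.value w := rfl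

/-! ### Labels on Schützenberger graphs and their products along words -/

section Cocycle

variable {G : Type w} [Group G] (lab : X → M → G)

/-- The label of a step from `m` along a letter. -/
def letterLabel (a : X × Bool) (m : M) : G :=
  bif a.2 then lab a.1 m else (lab a.1 (m * P.value (.of (a.1, false))))⁻¹

/-- The product of the labels along the path from `m` that reads a word. -/
def cocycle : List (X × Bool) → M → G
  | [], _ => 1
  | a :: w, m => P.letterLabel lab a m * cocycle w (m * P.value (.of a))

theorem value_cons (a : X × Bool) (w : List (X × Bool)) :
    P.value (.ofList (a :: w)) = P.value (.of a) * P.value (.ofList w) :=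
  map_mul P.value (.of a) (.ofList w)

theorem treeValue_cons (a : X × Bool) (w : List (X × Bool)) :
    P.treeValue (.ofList (a :: w)) = P.treeValue (.of a) * P.treeValue (.ofList w) :=
  map_mul P.treeValue (.of a) (.ofList w)

theorem cocycle_append (v w : List (X × Bool)) (m : M) :
    P.cocycle lab (v ++ w) m = P.cocycle lab v m * P.cocycle lab w (m * P.value (.ofList v)) := by
  induction v generalizing m with
  | nil =>
    have h : P.value (FreeMonoid.ofList []) = 1 := map_one P.value
    rw [h, mul_one]; exact (one_mul _).symm
  | cons a v ih =>
    rw [List.cons_append, cocycle, cocycle, ih, value_cons, mul_assoc, mul_assoc]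

/-- Traversing an edge backwards inverts its label. For a positive letter the hypothesis is needed,
so that the backward step returns to `m`; for a negative letter this is the definition of the label.
-/
theorem letterLabel_inv (a : X × Bool) {m : M}
    (h : m * P.value (.of a) * (P.value (.of a))⁻¹ = m) :
    P.letterLabel lab (a.1, !a.2) (m * P.value (.of a)) = (P.letterLabel lab a m)⁻¹ := by
  rcases a with ⟨x, _ | _⟩
  · simp [letterLabel]
  · have hx : P.value (.of (x, false)) = (P.value (.of (x, true)))⁻¹ :=
      P.value_inv (.of (x, true))
    simp only [letterLabel, Bool.not_true, cond_false, cond_true, hx, h]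

theorem cocycle_mul (v w : FreeMonoid (X × Bool)) (m : M) :
    P.cocycle lab (v * w).toList m =
      P.cocycle lab v.toList m * P.cocycle lab w.toList (m * P.value v) :=
  P.cocycle_append lab v.toList w.toList m

/-- Reading the inverse word from the end of the path retraces it. The hypothesis says that the path
from `m` stays in its Schützenberger graph, so every single step can be undone. -/
theorem cocycle_invRev (v : List (X × Bool)) {m : M}
    (h : m * P.value (.ofList v) * (P.value (.ofList v))⁻¹ = m) :
    P.cocycle lab (FreeGroup.invRev v) (m * P.value (.ofList v)) = (P.cocycle lab v m)⁻¹ := by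
  induction v generalizing m with
  | nil => exact inv_one.symm
  | cons a v ih =>
    rw [value_cons] at h ⊢
    have h2 := mul_mul_inv_right h
    have hv : P.value (.ofList (FreeGroup.invRev v)) = (P.value (.ofList v))⁻¹ :=
      P.value_inv (.ofList v)
    have hc : FreeGroup.invRev (a :: v) = FreeGroup.invRev v ++ [(a.1, !a.2)] := by
      simp [FreeGroup.invRev]
    rw [hc, cocycle_append, ← mul_assoc m, ih h2, hv, h2, cocycle, cocycle, cocycle, mul_one,
      letterLabel_inv P lab a (mul_mul_inv_left h), mul_inv_rev]

theorem cocycle_mul_invWord (v : FreeMonoid (X × Bool)) {m : M}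
    (h : m * P.value v * (P.value v)⁻¹ = m) : P.cocycle lab (v * invWord v).toList m = 1 := by
  rw [cocycle_mul]
  exact (congrArg _ (P.cocycle_invRev lab v.toList h)).trans (mul_inv_cancel _)

/-- Words with the same value whose cocycles agree wherever the words can be read. -/
def cocycleCon : Con (FreeMonoid (X × Bool)) where
  r v w := P.value v = P.value w ∧ ∀ m, m * P.value v * (P.value v)⁻¹ = m →
    P.cocycle lab v.toList m = P.cocycle lab w.toList m
  iseqv :=
    { refl := fun _ => ⟨rfl, fun _ _ => rfl⟩
      symm := fun h => ⟨h.1.symm, fun m hm => (h.2 m (by rwa [h.1])).symm⟩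
      trans := fun h h' => ⟨h.1.trans h'.1, fun m hm =>
        (h.2 m hm).trans (h'.2 m (by rwa [← h.1]))⟩ }
  mul' {v v' w w'} h h' := by
    refine ⟨by rw [map_mul, map_mul, h.1, h'.1], fun m hm => ?_⟩
    rw [map_mul] at hm
    rw [cocycle_mul, cocycle_mul, h.2 m (mul_mul_inv_left hm), h'.2 _ (mul_mul_inv_right hm), h.1]

/-- A word `vv⁻¹` that can be read from `m` is a path there and back: it returns to `m` with trivial
label. So both sides of the commuting relation have trivial label, and in `ww⁻¹w` only the last
factor counts. -/
theorem wagnerCon_le_cocycleCon : wagnerCon X ≤ P.cocycleCon lab := by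
  rw [wagnerCon, Con.conGen_le]
  intro a b hab
  cases hab with
  | regular =>
    have hv : P.value (b * invWord b * b) = P.value b := by
      rw [map_mul, map_mul, value_inv, mul_inv_mul]
    refine ⟨hv, fun m hm => ?_⟩
    rw [hv] at hm
    rw [cocycle_mul, cocycle_mul_invWord P lab b hm, one_mul, map_mul, value_inv, ← mul_assoc, hm]
  | commute v w =>
    have hc := idem_comm (mul_inv_idem (P.value v)) (mul_inv_idem (P.value w))
    have hval : ∀ v : FreeMonoid (X × Bool),
        P.value (v * invWord v) = P.value v * (P.value v)⁻¹ := fun v => by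
      rw [map_mul, value_inv]
    have key : ∀ {m n : M}, n * (m * m⁻¹) * (m * m⁻¹)⁻¹ = n → n * m * m⁻¹ = n := by
      intro m n h
      rwa [idem_inv (mul_inv_idem m), mul_assoc n, mul_inv_idem, ← mul_assoc] at h
    refine ⟨by rw [map_mul, hval, hval, map_mul, hval, hval, hc], fun m hm => ?_⟩
    rw [map_mul, hval, hval] at hm
    have hv := key (mul_mul_inv_left hm)
    have hw := key (mul_mul_inv_left (hc ▸ hm))
    rw [cocycle_mul P lab (v * _), cocycle_mul P lab (w * _), hval, hval, ← mul_assoc, ← mul_assoc,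
      hv, hw,
      cocycle_mul_invWord P lab v hv, cocycle_mul_invWord P lab w hw]

theorem cocycleCon_of_ofWord_eq {v w : FreeMonoid (X × Bool)} (h : FIM.ofWord v = FIM.ofWord w) :
    P.cocycleCon lab v w :=
  P.wagnerCon_le_cocycleCon lab ((wagnerCon X).eq.1 h)

/-- The words `uu` and `u` have the same label at `m`, and `u` is a loop there, so the label
satisfies `c² = c` in a group. -/
theorem cocycle_eq_one_of_idem {u : FreeMonoid (X × Bool)}
    (hu : FIM.ofWord u * FIM.ofWord u = FIM.ofWord u) {m : M} (hm : m * P.value u = m) :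
    P.cocycle lab u.toList m = 1 := by
  have h := cocycleCon_of_ofWord_eq P lab (v := u * u) (w := u) (by rw [map_mul, hu])
  have hv : P.value u * P.value u = P.value u := by rw [← map_mul, h.1]
  have h2 := h.2 m (by rw [map_mul, hv, idem_inv hv, hm, hm])
  rw [cocycle_mul, hm] at h2
  exact mul_eq_left.1 h2

/-- Words identified by `θ_min` become equal in the free inverse monoid after multiplication by an
idempotent word `u` that is a loop at the common end point. The label of this loop is trivial and
cancels. -/
theorem cocycleCon_of_treeValue_eq {v w : FreeMonoid (X × Bool)}
    (h : P.treeValue v = P.treeValue w) : P.cocycleCon lab v w := by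
  obtain ⟨e, he, h1, h2⟩ : MinRel P.θ (FIM.ofWord v) (FIM.ofWord w) := (minCon P.θ).eq.1 h
  obtain ⟨u, hu⟩ := FIM.ofWord_surjective e.val
  have hvw : P.value v = P.value w := congrArg P.sep.ψ h
  have huv : P.value u = (P.value v)⁻¹ * P.value v := by
    change P.θ (FIM.ofWord u) = (P.θ (FIM.ofWord v))⁻¹ * P.θ (FIM.ofWord v)
    rw [hu, ← h1, map_mul, map_inv']
  have hvu : P.value v * P.value u = P.value v := by rw [huv, ← mul_assoc, mul_inv_mul]
  refine ⟨hvw, fun m hm => ?_⟩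
  have hc := (cocycleCon_of_ofWord_eq P lab (v := v * u) (w := w * u)
    (by rw [map_mul, map_mul, hu, he])).2 m (by rw [map_mul, hvu, hm])
  have h1 := cocycle_eq_one_of_idem P lab (u := u) (by rw [hu, e.idem]) (m := m * P.value v)
    (by rw [mul_assoc, hvu])
  rwa [cocycle_mul, cocycle_mul, ← hvw, h1, mul_one, mul_one] at hc

end Cocycle

/-- The groups `K_e` are projective. -/
theorem exists_section (e : Idem P.T) {G : Type w} [Group G] (f : G →* SepQuotient.Ker P.sep e)
    (hf : Function.Surjective f) : ∃ σ : SepQuotient.Ker P.sep e →* G, ∀ k, f (σ k) = k := by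
  classical
  -- A transversal normalised at the base vertex, so that the conjugation left after telescoping is
  -- by `e` and hence trivial.
  obtain ⟨t, ht, hte⟩ : ∃ t : M → P.T, (∀ m, P.sep.ψ (t m) = m) ∧
      t (P.sep.ψ e.val) = e.val := by
    refine ⟨Function.update P.sep.pick (P.sep.ψ e.val) e.val, fun m => ?_,
      Function.update_self _ _ _⟩
    by_cases h : m = P.sep.ψ e.val
    · rw [h, Function.update_self]
    · rw [Function.update_of_ne h, P.sep.ψ_pick]
  -- For an edge `m → mx` of the Schützenberger graph of `e`, the element `t(m) x t(mx)⁻¹` lies over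
  -- `mxx⁻¹m⁻¹ = mm⁻¹`, hence in `K_e`, and can be lifted to `G`. Elsewhere the label is irrelevant
  -- and is set to `1`.
  have hloop : ∀ (x : X) (m : M), ∃ g : G, m * m⁻¹ = P.sep.ψ e.val →
      m * P.value (.of (x, true)) * (P.value (.of (x, true)))⁻¹ = m →
      (f g).val = t m * P.treeValue (.of (x, true)) * (t (m * P.value (.of (x, true))))⁻¹ := by
    intro x m
    by_cases h : m * m⁻¹ = P.sep.ψ e.val ∧
        m * P.value (.of (x, true)) * (P.value (.of (x, true)))⁻¹ = m
    · obtain ⟨g, hg⟩ := hf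
        ⟨t m * P.treeValue (.of (x, true)) * (t (m * P.value (.of (x, true))))⁻¹, by
          rw [map_mul, map_mul, map_inv', ht, ht, ψ_treeValue, mul_inv_rev', ← mul_assoc, h.2,
            h.1]⟩
      exact ⟨g, fun _ _ => by rw [hg]⟩
    · exact ⟨1, fun h1 h2 => (h ⟨h1, h2⟩).elim⟩
  choose lab hlab using hloop
  have hletter : ∀ (a : X × Bool) (m : M), m * m⁻¹ = P.sep.ψ e.val →
      m * P.value (.of a) * (P.value (.of a))⁻¹ = m →
      (f (P.letterLabel lab a m)).val = t m * P.treeValue (.of a) * (t (m * P.value (.of a)))⁻¹ := by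
    rintro ⟨x, _ | _⟩ m h1 h2
    · have hx : P.value (.of (x, false)) = (P.value (.of (x, true)))⁻¹ :=
        P.value_inv (.of (x, true))
      have hx' : P.treeValue (.of (x, false)) = (P.treeValue (.of (x, true)))⁻¹ :=
        P.treeValue_inv (.of (x, true))
      rw [hx, inv_inv'] at h2
      have h3 := hlab x (m * (P.value (.of (x, true)))⁻¹)
        (by rw [mul_inv_rev', inv_inv', ← mul_assoc, h2, h1]) (by rw [h2])
      rw [h2] at h3
      simp only [letterLabel, cond_false, map_inv]
      change (f _).val⁻¹ = _
      rw [hx, h3, hx', mul_inv_rev', mul_inv_rev', inv_inv', mul_assoc]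
    · exact hlab x m h1 h2
  -- The product of the edge elements telescopes along the path.
  have hword : ∀ (w : List (X × Bool)) (m : M), m * m⁻¹ = P.sep.ψ e.val →
      m * P.value (.ofList w) * (P.value (.ofList w))⁻¹ = m →
      (f (P.cocycle lab w m)).val =
        t m * P.treeValue (.ofList w) * (t (m * P.value (.ofList w)))⁻¹ := by
    intro w
    induction w with
    | nil =>
      intro m h1 _
      have hv : P.value (FreeMonoid.ofList []) = 1 := map_one P.value
      have hv' : P.treeValue (FreeMonoid.ofList []) = 1 := map_one P.treeValue
      rw [cocycle, map_one, hv, hv', mul_one, mul_one]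
      change e.val = _
      refine P.sep.idem_eq e.idem (mul_inv_idem _) ?_
      rw [map_mul, map_inv', ht, h1]
    | cons a w ih =>
      intro m h1 h2
      rw [value_cons] at h2
      have h3 := mul_mul_inv_left h2
      -- The inner factors cancel only up to an idempotent. It equals `u⁻¹u` for the element `u` to
      -- its left, because the two underlying elements have the same image in `M`, and so it is
      -- absorbed.
      have hk : t m * P.treeValue (.of a) * ((t (m * P.value (.of a)))⁻¹ *
          t (m * P.value (.of a))) = t m * P.treeValue (.of a) := by
        rw [P.sep.inv_mul_eq (a := t (m * P.value (.of a))) (b := t m * P.treeValue (.of a))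
          (by rw [map_mul, ht, ht, ψ_treeValue]), ← mul_assoc, mul_inv_mul]
      rw [cocycle, map_mul]
      change (f _).val * (f _).val = _
      rw [hletter a m h1 h3, ih _ (by rw [mul_inv_rev', ← mul_assoc, h3, h1])
        (mul_mul_inv_right h2), value_cons, treeValue_cons, ← mul_assoc m]
      calc _ = t m * P.treeValue (.of a) * ((t (m * P.value (.of a)))⁻¹ *
            t (m * P.value (.of a))) * P.treeValue (.ofList w) *
            (t (m * P.value (.of a) * P.value (.ofList w)))⁻¹ := by simp only [mul_assoc]
        _ = _ := by rw [hk]; simp only [mul_assoc]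
  have hrep : ∀ k : SepQuotient.Ker P.sep e, ∃ w, P.treeValue w = k.val := by
    intro k
    obtain ⟨a, ha⟩ := P.τ_surjective k.val
    obtain ⟨w, rfl⟩ := FIM.ofWord_surjective a
    exact ⟨w, ha⟩
  choose r hr using hrep
  have hrv : ∀ k, P.value (r k) = P.sep.ψ e.val := fun k => by
    rw [← ψ_treeValue, hr, k.ψ_val]
  have hee : P.sep.ψ e.val * P.sep.ψ e.val = P.sep.ψ e.val := by rw [← map_mul, e.idem]
  have hdom : P.sep.ψ e.val * P.sep.ψ e.val * (P.sep.ψ e.val)⁻¹ = P.sep.ψ e.val := by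
    rw [idem_inv hee, hee, hee]
  -- The section reads a word for `k` from the base vertex. It is multiplicative because the word
  -- for `kk'` and the concatenated words agree in `𝒯`, and the first of the concatenated words
  -- returns to the base vertex.
  refine ⟨MonoidHom.mk' (fun k => P.cocycle lab (r k).toList (P.sep.ψ e.val)) fun k k' => ?_,
    fun k => SepQuotient.Ker.ext ?_⟩
  · have h := cocycleCon_of_treeValue_eq P lab (v := r (k * k')) (w := r k * r k')
      (by rw [map_mul, hr, hr, hr]; rfl)
    rw [h.2 _ (by rw [hrv, hdom]), cocycle_mul, hrv, hee]
  · have h := hword (r k).toList (P.sep.ψ e.val) (by rw [idem_inv hee, hee])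
      (by rw [FreeMonoid.ofList_toList, hrv, hdom])
    refine h.trans ?_
    rw [FreeMonoid.ofList_toList, hrv, hee, hte, hr, idem_inv e.idem,
      P.sep.idem_mul_of_ker k.ψ_val, P.sep.mul_idem_of_ker k.ψ_val]

end InvPresentation

theorem mainTheorem1 {X : Type u} {M : Type v} [InverseMonoid M] (P : InvPresentation X M) :
    LauschModule.ShortExact P.inclusion P.rangeMap ∧
      LauschModule.IsFree.{v, u, u} P.squierModule :=
  -- Projectivity of `K_e` is applied to the range map itself, with `G = star_e`.
  ⟨P.sep.shortExact_of_section fun e => P.exists_section e _ SepQuotient.Star.range_surjective,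
    SepQuotient.starModule_isFree⟩
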